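/- Let $(\Omega,\mathcal F,\Pr)$ be a probability space, let $\theta:\Omega\to\Omega$ be an invertible (bi-measurable) ergodic probability-preserving transformation, let $\mathcal A$ be a finite set and let $M_d$ be the space of complex $d\times d$ matrices. Let $\mathcal V=\{V_{a;\omega}\}_{a\in\mathcal A}$ be a disordered perfect Kraus measurement ensemble, i.e. the maps $\omega\mapsto V_{a;\omega}\in M_d$ are measurable and $\sum_{a\in\mathcal A}V_{a;\omega}^\dagger V_{a;\omega}=1$ for almost every $\omega$. For $\bar a=(a_1,\dots,a_n)\in\mathcal A^n$ put $V^{(n)}_{\bar a;\omega}=V_{a_n;\theta^n(\omega)}\cdots V_{a_1;\theta(\omega)}$. For a state $\varrho$ (a positive semidefinite matrix of trace $1$) let $\mathbb Q_{\varrho;\omega}$ be the probability measure on $\mathcal A^{\mathbb N}$ (defined for almost every $\omega$, simultaneously for all $\varrho$) under which the first $n$ outcomes equal $\bar a\in\mathcal A^n$ with probability $\operatorname{tr}\big(V^{(n)}_{\bar a;\omega}\varrho V^{(n)\dagger}_{\bar a;\omega}\big)$, and let $$\rho^{(n)}_{\varrho;\omega}(\bar a)=\frac{V^{(n)}_{\bar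 a;\omega}\varrho V^{(n)\dagger}_{\bar a;\omega}}{\operatorname{tr}\big(V^{(n)}_{\bar a;\omega}\varrho V^{(n)\dagger}_{\bar a;\omega}\big)}$$ be the state after $n$ measurements. The purification event $X_{\mathcal V}$ is the set of those $\omega$ such that for every state $\varrho$, $\mathbb Q_{\varrho;\omega}$-almost surely, $\lim_{n\to\infty}\operatorname{tr}\big((\rho^{(n)}_{\varrho;\omega})^m\big)=1$ for all integers $m\ge1$; $\mathcal V$ asymptotically purifies if almost every $\omega$ belongs to $X_{\mathcal V}$. Let $\mathcal D_\omega$ be the set of dark projections: the orthogonal projections $p\in M_d$ of rank at least $2$ such that for all $n$ and all $\bar a\in\mathcal A^n$ there is $\lambda\in[0,1]$ with $pV^{(n)\dagger}_{\bar a;\omega}V^{(n)}_{\bar a;\omega}p=\lambda p$. Then: 1. $\omega\mapsto\mathcal D_\omega$ is a random compact set: every $\mathcal D_\omega$ is compact (possibly empty), and $\omega\mapsto\mathcal D_\omega$ is measurable with respect to the Borel $\sigma$-algebra of the Hausdorff metric on the compact subsets of $M_d$; moreover $\{\omega:\mathcal D_\omega\cap K\ne\emptyset\}$ is measurable for every compact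 $K\subset M_d$. 2. Up to a $\Pr$-null set, $X_{\mathcal V}=\{\omega:\mathcal D_\omega=\emptyset\}$. 3. $\mathcal V$ asymptotically purifies if and only if $\Pr(\{\omega:\mathcal D_\omega=\emptyset\})>0$. -/

import Mathlib

open MeasureTheory Filter Topology
open scoped ENNReal Matrix ComplexOrder

namespace DisorderedKraus

section Trajectories

variable {Ω A : Type*} {d : ℕ}

/-- `𝒱 = {V_{a;ω}}_{a ∈ A}` (written `V ω a`) is a disordered perfect Kraus measurement ensemble
with finite outcome set `A` on `ℂ^d`: the matrices depend measurably on the disorder `ω`, and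
almost surely `∑ₐ V_{a;ω}† V_{a;ω} = 1`. -/
structure IsPerfectKrausEnsemble [MeasurableSpace Ω] [Fintype A] (P : Measure Ω)
    (V : Ω → A → Matrix (Fin d) (Fin d) ℂ) : Prop where
  measurable : ∀ a i j, Measurable fun ω => V ω a i j
  sum_eq_one : ∀ᵐ ω ∂P, ∑ a, (V ω a)ᴴ * V ω a = 1

/-- The `n`-step Kraus operator
`V^{(n)}_{(a₁,…,aₙ);ω} = V_{aₙ;θⁿω} ⋯ V_{a₂;θ²ω} V_{a₁;θω}`;
the outcome `aₖ` is `a (k - 1)` in the indexing by `Fin n`. -/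
noncomputable def krausProduct (V : Ω → A → Matrix (Fin d) (Fin d) ℂ) (θ : Ω → Ω) (ω : Ω) :
    (n : ℕ) → (Fin n → A) → Matrix (Fin d) (Fin d) ℂ
  | 0, _ => 1
  | n + 1, a =>
      V (θ^[n + 1] ω) (a (Fin.last n)) * krausProduct V θ ω n (fun i => a i.castSucc)

/-- Quantum states (density matrices) on `ℂ^d`. -/
def IsState (ϱ : Matrix (Fin d) (Fin d) ℂ) : Prop := ϱ.PosSemidef ∧ ϱ.trace = 1

/-- The probability `tr (V^{(n)}_{ā;ω} ϱ V^{(n)†}_{ā;ω})` of observing the outcomes `ā ∈ Aⁿ`. -/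
noncomputable def outcomeWeight (V : Ω → A → Matrix (Fin d) (Fin d) ℂ) (θ : Ω → Ω)
    (ϱ : Matrix (Fin d) (Fin d) ℂ) (ω : Ω) (n : ℕ) (a : Fin n → A) : ℝ :=
  (krausProduct V θ ω n a * ϱ * (krausProduct V θ ω n a)ᴴ).trace.re

/-- The set of outcome sequences that begin with `b ∈ Aⁿ`. -/
def cyl (n : ℕ) (b : Fin n → A) : Set (ℕ → A) := {a | ∀ i : Fin n, a i = b i}

/-- `μ` is the law of the outcome sequence: a probability measure on `A^ℕ` that gives the cylinder
over `ā ∈ Aⁿ` the mass `tr (V^{(n)}_{ā;ω} ϱ V^{(n)†}_{ā;ω})`. -/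
def IsQuantumProbability [MeasurableSpace A] (V : Ω → A → Matrix (Fin d) (Fin d) ℂ) (θ : Ω → Ω)
    (ϱ : Matrix (Fin d) (Fin d) ℂ) (ω : Ω) (μ : Measure (ℕ → A)) : Prop :=
  IsProbabilityMeasure μ ∧
    ∀ n b, μ (cyl n b) = ENNReal.ofReal (outcomeWeight V θ ϱ ω n b)

open scoped Classical in
/-- The quantum probability `ℚ_{ϱ;ω}` on `A^ℕ`. It is determined by its cylinder masses (see
`IsQuantumProbability.unique` below), and exists for all states `ϱ` as soon as the Kraus condition
holds along the orbit of `ω` (see `isQuantumProbability_quantumProbability` below); for the other `ω`, a null set, a conventional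
value is used. -/
noncomputable def quantumProbability [MeasurableSpace A]
    (V : Ω → A → Matrix (Fin d) (Fin d) ℂ) (θ : Ω → Ω)
    (ϱ : Matrix (Fin d) (Fin d) ℂ) (ω : Ω) : Measure (ℕ → A) :=
  if h : ∃ μ, IsQuantumProbability V θ ϱ ω μ then h.choose else 0

/-- The state `ρ^{(n)}_{ϱ;ω}(ā)` after `n` measurements with outcomes `a₁, …, aₙ`. (Where the
denominator vanishes the value is irrelevant: such outcomes have probability zero.) -/
noncomputable def trajectory (V : Ω → A → Matrix (Fin d) (Fin d) ℂ) (θ : Ω → Ω)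
    (ϱ : Matrix (Fin d) (Fin d) ℂ) (ω : Ω) (n : ℕ) (a : ℕ → A) : Matrix (Fin d) (Fin d) ℂ :=
  let W := krausProduct V θ ω n (fun i => a i)
  (W * ϱ * Wᴴ).trace⁻¹ • (W * ϱ * Wᴴ)

/-- The purification event `X_𝒱`: the disorder realizations `ω` such that, for every initial state
`ϱ`, `ℚ_{ϱ;ω}`-almost surely `tr ((ρ^{(n)}_{ϱ;ω})^m) → 1` as `n → ∞` for every `m ≥ 1`. -/
def purificationEvent [MeasurableSpace A] (V : Ω → A → Matrix (Fin d) (Fin d) ℂ) (θ : Ω → Ω) :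
    Set Ω :=
  {ω | ∀ ϱ, IsState ϱ → ∀ᵐ a ∂(quantumProbability V θ ϱ ω), ∀ m : ℕ, 1 ≤ m →
    Tendsto (fun n => (trajectory V θ ϱ ω n a ^ m).trace) atTop (𝓝 1)}

/-- `𝒱` asymptotically purifies: the purification event has full probability. -/
def AsymptoticallyPurifies [MeasurableSpace Ω] [MeasurableSpace A] (P : Measure Ω)
    (V : Ω → A → Matrix (Fin d) (Fin d) ℂ) (θ : Ω → Ω) : Prop :=
  ∀ᵐ ω ∂P, ω ∈ purificationEvent V θ

/-- The `N`-gray projections of rank `r`: orthogonal projections `p` of rank `r` such that for every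
`ā ∈ A^N` there is `l ∈ [0, 1]` with `p V^{(N)†}_{ā;ω} V^{(N)}_{ā;ω} p = l p`. -/
def grayProjections (V : Ω → A → Matrix (Fin d) (Fin d) ℂ) (θ : Ω → Ω) (N r : ℕ) (ω : Ω) :
    Set (Matrix (Fin d) (Fin d) ℂ) :=
  {p | IsStarProjection p ∧ p.rank = r ∧ ∀ a : Fin N → A, ∃ l : ℝ, 0 ≤ l ∧ l ≤ 1 ∧
    p * ((krausProduct V θ ω N a)ᴴ * krausProduct V θ ω N a) * p = (l : ℂ) • p}

/-- The set `𝒟_ω` of dark projections, i.e. `⋂_N ⋃_{2 ≤ r ≤ d} 𝒢_ω^{(N,r)}`. -/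
def darkProjections (V : Ω → A → Matrix (Fin d) (Fin d) ℂ) (θ : Ω → Ω) (ω : Ω) :
    Set (Matrix (Fin d) (Fin d) ℂ) :=
  ⋂ N : ℕ, ⋃ r ∈ Set.Icc 2 d, grayProjections V θ N r ω

/-- A random compact set: a map with values in the compact subsets (`∅` included) of `E` that is
measurable for the Borel `σ`-algebra of the space `Compacts E`. The topology of `Compacts E` is
Vietoris' topology, which for every metric that induces the topology of `E` is that of the Hausdorff metric. -/
def IsRandomCompactSet {E : Type*} [MeasurableSpace Ω] [TopologicalSpace E] (D : Ω → Set E) :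
    Prop :=
  ∃ K : Ω → TopologicalSpace.Compacts E, (∀ ω, (K ω : Set E) = D ω) ∧
    Measurable[_, borel (TopologicalSpace.Compacts E)] K

end Trajectories

section Existence

variable {Ω A : Type*} {d : ℕ}

theorem measurableSet_cyl [Countable A] [MeasurableSpace A] [DiscreteMeasurableSpace A]
    (n : ℕ) (b : Fin n → A) : MeasurableSet (cyl n b) := by
  have : cyl n b = ⋂ i : Fin n, (fun a : ℕ → A => a i) ⁻¹' {b i} := by
    ext a; simp [cyl]
  rw [this]
  exact MeasurableSet.iInter fun i => (measurable_pi_apply _) (MeasurableSet.of_discrete)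

/-- Consistent weights on `Aⁿ`, `n ∈ ℕ`, are the cylinder masses of a probability measure. -/
theorem exists_measure_of_weights [Fintype A] [MeasurableSpace A] [DiscreteMeasurableSpace A]
    (w : ∀ n, (Fin n → A) → ℝ≥0∞) (h0 : ∀ b, w 0 b = 1)
    (hs : ∀ n b, ∑ a, w (n + 1) (Fin.snoc b a) = w n b) :
    ∃ μ : Measure (ℕ → A), IsProbabilityMeasure μ ∧ ∀ n b, μ (cyl n b) = w n b := by
  classical
  obtain ⟨a0⟩ : Nonempty A := by
    by_contra hA
    rw [not_nonempty_iff] at hA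
    have := hs 0 default
    rw [h0] at this
    simp at this
  let pad : ∀ n, (Fin n → A) → (ℕ → A) := fun n b i => if h : i < n then b ⟨i, h⟩ else a0
  let ν : ℕ → Measure (ℕ → A) := fun n => ∑ b : Fin n → A, w n b • Measure.dirac (pad n b)
  have key : ∀ k (b : Fin k → A) m, ν (k + m) (cyl k b) = w k b := by
    intro k b m
    have e : ∀ n, ν n (cyl k b) = ∑ c : Fin n → A, if pad n c ∈ cyl k b then w n c else 0 := by
      intro n
      simp only [ν, Measure.finsetSum_apply, Measure.smul_apply, smul_eq_mul,
        Measure.dirac_apply' _ (measurableSet_cyl k b), Set.indicator_apply, Pi.one_apply,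
        mul_ite, mul_one, mul_zero]
    induction m with
    | zero =>
      simp only [add_zero]
      rw [e, Finset.sum_eq_single b]
      · simp [pad, cyl]
      · intro c _ hc
        rw [if_neg]
        intro h
        apply hc
        funext i
        have := h i
        simpa [pad] using this
      · simp
    | succ m ih =>
      rw [← ih, e, e, ← add_assoc, ← (Fin.snocEquiv fun _ : Fin (k + m + 1) => A).sum_comp,
        Fintype.sum_prod_type_right]
      refine Finset.sum_congr rfl fun c _ => ?_
      have hp : ∀ x, pad (k + m + 1) (Fin.snoc c x) ∈ cyl k b ↔ pad (k + m) c ∈ cyl k b := by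
        intro x
        refine forall_congr' fun i => ?_
        have h1 : (i : ℕ) < k + m := by omega
        have h2 : (i : ℕ) < k + m + 1 := by omega
        have h3 : (⟨i, h2⟩ : Fin (k + m + 1)) = Fin.castSucc ⟨i, h1⟩ := rfl
        simp only [pad, h1, h2, dif_pos, h3]
        rw [Fin.snoc_castSucc (α := fun _ => A)]
      simp only [Fin.snocEquiv, Equiv.coe_fn_mk, hp]
      split_ifs
      · exact hs _ _
      · simp
  have hprob : ∀ n, IsProbabilityMeasure (ν n) := fun n => ⟨by
    have := key 0 default n
    rw [h0, zero_add] at this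
    rw [← this]
    congr 1
    ext a
    simp [cyl]⟩
  let _ : TopologicalSpace A := ⊥
  have : DiscreteTopology A := ⟨rfl⟩
  let π : ℕ → ProbabilityMeasure (ℕ → A) := fun n => ⟨ν n, hprob n⟩
  obtain ⟨μ, hμ⟩ := exists_clusterPt_of_compactSpace (map π atTop)
  obtain ⟨L, hL, hLμ⟩ := mapClusterPt_iff_ultrafilter.1 hμ
  refine ⟨μ, inferInstance, fun n b => ?_⟩
  have hclopen : IsClopen (cyl n b) := by
    have : cyl n b = ⋂ i : Fin n, (fun a : ℕ → A => a i) ⁻¹' {b i} := by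
      ext a; simp [cyl]
    rw [this]
    exact isClopen_iInter_of_finite fun i => (isClopen_discrete _).preimage (continuous_apply _)
  have h1 : Tendsto (fun k => ν k (cyl n b)) L (𝓝 ((μ : Measure (ℕ → A)) (cyl n b))) :=
    ProbabilityMeasure.tendsto_measure_of_null_frontier_of_tendsto' hLμ
      (by simp [hclopen.frontier_eq])
  have h2 : Tendsto (fun k => ν k (cyl n b)) L (𝓝 (w n b)) := by
    refine tendsto_const_nhds.congr' ?_
    filter_upwards [hL (Ici_mem_atTop n)] with k hk
    obtain ⟨m, rfl⟩ := Nat.exists_eq_add_of_le hk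
    exact (key n b m).symm
  exact tendsto_nhds_unique h1 h2

/-- Uniqueness of the quantum probability. -/
theorem IsQuantumProbability.unique [Fintype A] [MeasurableSpace A] [DiscreteMeasurableSpace A]
    {V : Ω → A → Matrix (Fin d) (Fin d) ℂ} {θ : Ω → Ω} {ϱ : Matrix (Fin d) (Fin d) ℂ} {ω : Ω}
    {μ ν : Measure (ℕ → A)} (hμ : IsQuantumProbability V θ ϱ ω μ)
    (hν : IsQuantumProbability V θ ϱ ω ν) : μ = ν := by
  have := hμ.1
  have := hν.1
  let C : Set (Set (ℕ → A)) := {s | s = ∅ ∨ ∃ n b, s = cyl n b}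
  have hC : ∀ s ∈ C, μ s = ν s := by
    rintro s (rfl | ⟨n, b, rfl⟩)
    · simp
    · rw [hμ.2, hν.2]
  have hpi : IsPiSystem C := by
    have aux : ∀ n m (b : Fin n → A) (c : Fin m → A), n ≤ m →
        cyl n b ∩ cyl m c = ∅ ∨ cyl n b ∩ cyl m c = cyl m c := by
      intro n m b c hnm
      rcases Set.eq_empty_or_nonempty (cyl n b ∩ cyl m c) with h | ⟨x, hx, hx'⟩
      · exact Or.inl h
      · refine Or.inr (Set.inter_eq_right.2 fun y hy i => ?_)
        have h1 : y i = c (Fin.castLE hnm i) := hy (Fin.castLE hnm i)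
        have h2 : x i = c (Fin.castLE hnm i) := hx' (Fin.castLE hnm i)
        rw [h1, ← h2, hx i]
    rintro s (rfl | ⟨n, b, rfl⟩) t (rfl | ⟨m, c, rfl⟩) _
    · exact Or.inl (by simp)
    · exact Or.inl (by simp)
    · exact Or.inl (by simp)
    · rcases le_total n m with h | h
      · exact (aux n m b c h).imp id fun e => ⟨m, c, e⟩
      · rw [Set.inter_comm]
        exact (aux m n c b h).imp id fun e => ⟨n, b, e⟩
  refine ext_of_generate_finite C (le_antisymm ?_ ?_) hpi hC (by simp)
  · refine iSup_le fun i => ?_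
    rintro s ⟨t, -, rfl⟩
    have : (fun a : ℕ → A => a i) ⁻¹' t
        = ⋃ b ∈ {b : Fin (i + 1) → A | b (Fin.last i) ∈ t}, cyl (i + 1) b := by
      ext a
      simp only [Set.mem_preimage, Set.mem_ofPred_eq, Set.mem_iUnion, exists_prop]
      constructor
      · exact fun h => ⟨fun j => a j, h, fun j => rfl⟩
      · rintro ⟨b, hb, h⟩
        have h' : a i = b (Fin.last i) := h (Fin.last i)
        rwa [h']
    rw [this]
    exact MeasurableSet.biUnion (Set.to_countable _) fun b _ =>
      MeasurableSpace.measurableSet_generateFrom (Or.inr ⟨_, b, rfl⟩)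
  · refine MeasurableSpace.generateFrom_le ?_
    rintro s (rfl | ⟨n, b, rfl⟩)
    · exact MeasurableSet.empty
    · exact measurableSet_cyl n b

/-- Existence of the quantum probability for every `ω` such that the Kraus condition holds along
the orbit of `ω`. -/
theorem isQuantumProbability_quantumProbability [Fintype A] [MeasurableSpace A]
    [DiscreteMeasurableSpace A] (V : Ω → A → Matrix (Fin d) (Fin d) ℂ) (θ : Ω → Ω)
    (ϱ : Matrix (Fin d) (Fin d) ℂ) (hϱ : IsState ϱ) (ω : Ω)
    (hω : ∀ n, ∑ a, (V (θ^[n + 1] ω) a)ᴴ * V (θ^[n + 1] ω) a = 1) :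
    IsQuantumProbability V θ ϱ ω (quantumProbability V θ ϱ ω) := by
  have hex : ∃ μ, IsQuantumProbability V θ ϱ ω μ := by
    refine exists_measure_of_weights
      (fun n b => ENNReal.ofReal (outcomeWeight V θ ϱ ω n b)) ?_ ?_
    · intro b
      simp [outcomeWeight, krausProduct, hϱ.2]
    · intro n b
      have hpos : ∀ k c, 0 ≤ outcomeWeight V θ ϱ ω k c := fun k c =>
        (Complex.le_def.1 (hϱ.1.mul_mul_conjTranspose_same _).trace_nonneg).1
      rw [← ENNReal.ofReal_sum_of_nonneg fun a _ => hpos _ _]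
      congr 1
      simp only [outcomeWeight, krausProduct, Fin.snoc_last, Fin.snoc_castSucc]
      rw [← Complex.re_sum, ← Matrix.trace_sum]
      set W := krausProduct V θ ω n b
      have : ∀ a, (V (θ^[n + 1] ω) a * W * ϱ * (V (θ^[n + 1] ω) a * W)ᴴ).trace
          = ((V (θ^[n + 1] ω) a)ᴴ * V (θ^[n + 1] ω) a * (W * ϱ * Wᴴ)).trace := by
        intro a
        rw [Matrix.mul_assoc _ᴴ, Matrix.trace_mul_comm (V _ a)ᴴ, Matrix.conjTranspose_mul]
        simp only [Matrix.mul_assoc]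
      rw [Matrix.trace_sum, Finset.sum_congr rfl fun a _ => this a, ← Matrix.trace_sum,
        ← Finset.sum_mul, hω n, one_mul]
  unfold quantumProbability
  rw [dif_pos hex]
  exact hex.choose_spec

end Existence

end DisorderedKraus

/-! The argument follows the areas of parallelograms. By the AM-GM inequality, the area of the image
of an orthonormal pair under a Kraus operator is at most half the trace of the Gram matrix of the
image, and these half traces sum to one over the outcomes. So the area of a pair, summed over all
outcomes of `n` measurements, is nonincreasing in `n`. If it stays equal to one for an orthonormal
pair `X`, equality in AM-GM makes every Kraus product a multiple of an isometry on the span of `X`,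
and `X * Xᴴ` is a dark projection.

If there are no dark projections, compactness of the set of orthonormal pairs yields a contraction
of the total area by a factor below one after finitely many steps (`exists_contraction`). If this
happens with positive probability, ergodicity brings almost every orbit back infinitely often to one
fixed contraction event, and the total area tends to zero (`ae_tendsto_totalArea`). Divided by the
outcome probability, the area is a nonnegative supermartingale with vanishing mean, so a maximal
inequality sends it to zero almost surely. Its squares over pairs of columns of `B`, where `ϱ = B *
Bᴴ`, add up to the purity defect `1 - tr ρ²`, so the state purifies (`mem_purificationEvent`).

Conversely, the uniform state on a dark projection of rank `r` has purity `1 / r ≤ 1 / 2` forever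
(`notMem_purificationEvent`).

Measurability rests on writing the dark projections as the common zeros, in a fixed compact set, of
countably many functions continuous in `p` and measurable in `ω`. -/

namespace DisorderedKraus

/-! ### Areas of pairs of vectors under a Kraus measurement -/

section PairArea

variable {d : ℕ}

/-- The area of the parallelogram spanned by the two columns of `Y`. -/
noncomputable def pairArea (Y : Matrix (Fin d) (Fin 2) ℂ) : ℝ := √(Yᴴ * Y).det.re

theorem pairArea_nonneg (Y : Matrix (Fin d) (Fin 2) ℂ) : 0 ≤ pairArea Y := Real.sqrt_nonneg _

theorem continuous_pairArea : Continuous (pairArea (d := d)) := by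
  unfold pairArea
  fun_prop

theorem det_gram_nonneg (Y : Matrix (Fin d) (Fin 2) ℂ) : 0 ≤ (Yᴴ * Y).det :=
  (Matrix.posSemidef_conjTranspose_mul_self Y).det_nonneg

theorem pairArea_sq (Y : Matrix (Fin d) (Fin 2) ℂ) : pairArea Y ^ 2 = (Yᴴ * Y).det.re :=
  Real.sq_sqrt (Complex.le_def.1 (det_gram_nonneg Y)).1

theorem pairArea_mul (Y : Matrix (Fin d) (Fin 2) ℂ) (g : Matrix (Fin 2) (Fin 2) ℂ) :
    pairArea (Y * g) = ‖g.det‖ * pairArea Y := by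
  have h : ((Y * g)ᴴ * (Y * g)).det.re = ‖g.det‖ ^ 2 * (Yᴴ * Y).det.re := by
    have : (Y * g)ᴴ * (Y * g) = gᴴ * (Yᴴ * Y) * g := by
      simp only [Matrix.conjTranspose_mul, Matrix.mul_assoc]
    rw [this, Matrix.det_mul, Matrix.det_mul, Matrix.det_conjTranspose, mul_right_comm,
      Complex.star_def, ← Complex.normSq_eq_conj_mul_self, Complex.re_ofReal_mul,
      Complex.normSq_eq_norm_sq]
  rw [pairArea, h, Real.sqrt_mul (sq_nonneg _), Real.sqrt_sq (norm_nonneg _), pairArea]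

theorem gram_entries (Y : Matrix (Fin d) (Fin 2) ℂ) :
    ((Yᴴ * Y) 0 0).im = 0 ∧ ((Yᴴ * Y) 1 1).im = 0 ∧ 0 ≤ ((Yᴴ * Y) 0 0).re ∧
      0 ≤ ((Yᴴ * Y) 1 1).re ∧ (Yᴴ * Y) 1 0 = star ((Yᴴ * Y) 0 1) := by
  have h := Matrix.posSemidef_conjTranspose_mul_self Y
  have h0 := Complex.le_def.1 (h.diag_nonneg (i := 0))
  have h1 := Complex.le_def.1 (h.diag_nonneg (i := 1))
  exact ⟨h0.2.symm, h1.2.symm, h0.1, h1.1, (h.isHermitian.apply 1 0).symm⟩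

theorem pairArea_sq_eq (Y : Matrix (Fin d) (Fin 2) ℂ) :
    pairArea Y ^ 2 = ((Yᴴ * Y) 0 0).re * ((Yᴴ * Y) 1 1).re - ‖(Yᴴ * Y) 0 1‖ ^ 2 := by
  obtain ⟨h0, h1, -, -, h2⟩ := gram_entries Y
  rw [pairArea_sq, Matrix.det_fin_two, h2, Complex.star_def, Complex.mul_conj, Complex.sub_re,
    Complex.mul_re, h0, Complex.ofReal_re, Complex.normSq_eq_norm_sq]
  ring

theorem trace_gram_re (Y : Matrix (Fin d) (Fin 2) ℂ) :
    (Yᴴ * Y).trace.re = ((Yᴴ * Y) 0 0).re + ((Yᴴ * Y) 1 1).re := by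
  simp [Matrix.trace_fin_two]

theorem pairArea_le (Y : Matrix (Fin d) (Fin 2) ℂ) : pairArea Y ≤ (Yᴴ * Y).trace.re / 2 := by
  obtain ⟨-, -, h0, h1, -⟩ := gram_entries Y
  rw [trace_gram_re]
  refine abs_le_of_sq_le_sq' ?_ (by positivity) |>.2
  rw [pairArea_sq_eq]
  nlinarith [sq_nonneg ‖(Yᴴ * Y) 0 1‖, sq_nonneg (((Yᴴ * Y) 0 0).re - ((Yᴴ * Y) 1 1).re)]

/-- Equality case of AM-GM: with Gram entries `a`, `b` on the diagonal and `g` off it, the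
hypothesis squares to `|g|² + ((a - b) / 2)² ≤ 0`. -/
theorem gram_eq_smul_one_of_le_pairArea {Y : Matrix (Fin d) (Fin 2) ℂ}
    (h : (Yᴴ * Y).trace.re / 2 ≤ pairArea Y) : Yᴴ * Y = (((Yᴴ * Y).trace.re / 2 : ℝ) : ℂ) • 1 := by
  obtain ⟨i0, i1, h0, h1, h2⟩ := gram_entries Y
  rw [trace_gram_re] at h ⊢
  have hs := pairArea_sq_eq Y
  have hle := pow_le_pow_left₀ (by positivity) h 2
  rw [hs] at hle
  have e1 : ‖(Yᴴ * Y) 0 1‖ = 0 := by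
    nlinarith [sq_nonneg ‖(Yᴴ * Y) 0 1‖, sq_nonneg (((Yᴴ * Y) 0 0).re - ((Yᴴ * Y) 1 1).re)]
  have e2 : ((Yᴴ * Y) 0 0).re - ((Yᴴ * Y) 1 1).re = 0 := by
    rw [e1] at hle
    nlinarith [sq_nonneg (((Yᴴ * Y) 0 0).re - ((Yᴴ * Y) 1 1).re)]
  have e1' : (Yᴴ * Y) 0 1 = 0 := norm_eq_zero.1 e1
  rw [e1', star_zero] at h2
  generalize Yᴴ * Y = G at *
  ext i j
  fin_cases i <;> fin_cases j
  · apply Complex.ext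
    · simp; linarith
    · simpa using i0
  · simpa using e1'
  · simpa using h2
  · apply Complex.ext
    · simp; linarith
    · simpa using i1

theorem pairArea_mul_eq_zero {Y : Matrix (Fin d) (Fin 2) ℂ} (h : pairArea Y = 0)
    (W : Matrix (Fin d) (Fin d) ℂ) : pairArea (W * Y) = 0 := by
  have hdet : (Yᴴ * Y).det = 0 := by
    have h1 := pairArea_sq Y
    rw [h] at h1
    have h2 := (Complex.le_def.1 (det_gram_nonneg Y)).2
    exact Complex.ext (by simpa using h1.symm) (by simpa using h2.symm)
  obtain ⟨v, hv0, hv⟩ := Matrix.exists_mulVec_eq_zero_iff.2 hdet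
  have hYv : Y *ᵥ v = 0 := (Matrix.conjTranspose_mul_self_mulVec_eq_zero Y v).1 hv
  have hdet' : ((W * Y)ᴴ * (W * Y)).det = 0 := by
    refine Matrix.exists_mulVec_eq_zero_iff.1 ⟨v, hv0, ?_⟩
    rw [← Matrix.mulVec_mulVec, ← Matrix.mulVec_mulVec _ W, hYv]
    simp
  rw [pairArea, hdet', Complex.zero_re, Real.sqrt_zero]

-- Gram–Schmidt in matrix form: factor the Gram matrix as `gᴴ * g` and take `X = Y * g⁻¹`. Areas of
-- all images of `Y` are then those of `X` times the same factor `|det g|`.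
open scoped MatrixOrder in
theorem exists_isometry_mul {Y : Matrix (Fin d) (Fin 2) ℂ} (h : pairArea Y ≠ 0) :
    ∃ (X : Matrix (Fin d) (Fin 2) ℂ) (g : Matrix (Fin 2) (Fin 2) ℂ), Xᴴ * X = 1 ∧ Y = X * g := by
  have hpsd := Matrix.posSemidef_conjTranspose_mul_self Y
  have hdet : (Yᴴ * Y).det ≠ 0 := by
    intro h0
    exact h (by simp [pairArea, h0])
  obtain ⟨g, hg⟩ := CStarAlgebra.nonneg_iff_eq_star_mul_self.mp hpsd.nonneg
  rw [Matrix.star_eq_conjTranspose] at hg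
  have hgdet : IsUnit g.det := by
    rw [hg, Matrix.det_mul] at hdet
    exact (right_ne_zero_of_mul hdet).isUnit
  refine ⟨Y * g⁻¹, g, ?_, ?_⟩
  · have hgdet' : IsUnit gᴴ.det := by rw [Matrix.det_conjTranspose]; exact hgdet.star
    calc (Y * g⁻¹)ᴴ * (Y * g⁻¹) = (g⁻¹)ᴴ * (Yᴴ * Y) * g⁻¹ := by
          simp only [Matrix.conjTranspose_mul, Matrix.mul_assoc]
      _ = (gᴴ⁻¹ * gᴴ) * (g * g⁻¹) := by
          rw [hg, Matrix.conjTranspose_nonsing_inv]; simp only [Matrix.mul_assoc]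
      _ = 1 := by
          rw [Matrix.nonsing_inv_mul _ hgdet', Matrix.mul_nonsing_inv _ hgdet, one_mul]
  · rw [Matrix.mul_assoc, Matrix.nonsing_inv_mul _ hgdet, Matrix.mul_one]

theorem pairArea_eq_one {X : Matrix (Fin d) (Fin 2) ℂ} (hX : Xᴴ * X = 1) : pairArea X = 1 := by
  simp [pairArea, hX]

/-- Bounds on total areas need only be checked on orthonormal pairs. -/
theorem sum_pairArea_le_of_isometry {ι : Type*} [Fintype ι] {W : ι → Matrix (Fin d) (Fin d) ℂ}
    {c : ℝ} (h : ∀ X : Matrix (Fin d) (Fin 2) ℂ, Xᴴ * X = 1 → ∑ i, pairArea (W i * X) ≤ c)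
    (Y : Matrix (Fin d) (Fin 2) ℂ) : ∑ i, pairArea (W i * Y) ≤ c * pairArea Y := by
  by_cases h0 : pairArea Y = 0
  · simp [h0, fun i => pairArea_mul_eq_zero h0 (W i)]
  · obtain ⟨X, g, hX, rfl⟩ := exists_isometry_mul h0
    simp only [← Matrix.mul_assoc, pairArea_mul, ← Finset.mul_sum]
    rw [pairArea_eq_one hX, mul_one, mul_comm c]
    exact mul_le_mul_of_nonneg_left (h X hX) (norm_nonneg _)

/-- The Kraus condition preserves the total trace of the Gram matrix, which is 2 for an orthonormal
pair. -/
theorem sum_trace_gram {ι : Type*} [Fintype ι] {W : ι → Matrix (Fin d) (Fin d) ℂ}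
    (hW : ∑ i, (W i)ᴴ * W i = 1) {X : Matrix (Fin d) (Fin 2) ℂ} (hX : Xᴴ * X = 1) :
    ∑ i, ((W i * X)ᴴ * (W i * X)).trace.re / 2 = 1 := by
  have : ∑ i, (W i * X)ᴴ * (W i * X) = 1 := by
    calc ∑ i, (W i * X)ᴴ * (W i * X) = Xᴴ * (∑ i, (W i)ᴴ * W i) * X := by
          simp only [Matrix.conjTranspose_mul, Matrix.mul_assoc,
            Matrix.sum_mul, Matrix.mul_sum]
      _ = 1 := by rw [hW, Matrix.mul_one, hX]
  rw [← Finset.sum_div, ← Complex.re_sum, ← Matrix.trace_sum, this]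
  simp

theorem sum_pairArea_le {ι : Type*} [Fintype ι] {W : ι → Matrix (Fin d) (Fin d) ℂ}
    (hW : ∑ i, (W i)ᴴ * W i = 1) (Y : Matrix (Fin d) (Fin 2) ℂ) :
    ∑ i, pairArea (W i * Y) ≤ pairArea Y := by
  have := sum_pairArea_le_of_isometry (W := W) (c := 1) (fun X hX => ?_) Y
  · simpa using this
  · rw [← sum_trace_gram hW hX]
    exact Finset.sum_le_sum fun i _ => pairArea_le _

/-- If measuring does not shrink the total area of an orthonormal pair, then every Kraus operator
acts on its span as a multiple of an isometry. -/
theorem exists_gram_eq_smul_one {ι : Type*} [Fintype ι] {W : ι → Matrix (Fin d) (Fin d) ℂ}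
    (hW : ∑ i, (W i)ᴴ * W i = 1) {X : Matrix (Fin d) (Fin 2) ℂ} (hX : Xᴴ * X = 1)
    (h : 1 ≤ ∑ i, pairArea (W i * X)) (i : ι) :
    ∃ l : ℝ, 0 ≤ l ∧ l ≤ 1 ∧ (W i * X)ᴴ * (W i * X) = (l : ℂ) • 1 := by
  have hs := sum_trace_gram hW hX
  have hn : ∀ i, 0 ≤ ((W i * X)ᴴ * (W i * X)).trace.re / 2 := fun i =>
    (pairArea_nonneg _).trans (pairArea_le _)
  refine ⟨_, hn i, ?_, gram_eq_smul_one_of_le_pairArea ?_⟩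
  · rw [← hs]
    exact Finset.single_le_sum (f := fun i => ((W i * X)ᴴ * (W i * X)).trace.re / 2)
      (fun i _ => hn i) (Finset.mem_univ i)
  · have heq := (Finset.sum_eq_sum_iff_of_le fun i _ => pairArea_le (W i * X)).1
      (le_antisymm (Finset.sum_le_sum fun i _ => pairArea_le _) (hs.trans_le h))
    exact (heq i (Finset.mem_univ i)).ge

end PairArea

/-! ### Purity of a state -/

section Purity

variable {d : ℕ}

/-- The columns `i` and `j` of `C`. -/
def colPair (C : Matrix (Fin d) (Fin d) ℂ) (i j : Fin d) : Matrix (Fin d) (Fin 2) ℂ :=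
  C.submatrix id ![i, j]

theorem mul_colPair (W C : Matrix (Fin d) (Fin d) ℂ) (i j : Fin d) :
    W * colPair C i j = colPair (W * C) i j := rfl

/-- The purity defect of `C Cᴴ` in terms of areas of pairs of columns. -/
theorem trace_sq_sub_trace_sq (C : Matrix (Fin d) (Fin d) ℂ) :
    ((C * Cᴴ).trace ^ 2 - ((C * Cᴴ) ^ 2).trace).re = ∑ i, ∑ j, pairArea (colPair C i j) ^ 2 := by
  have h1 : (C * Cᴴ).trace = (Cᴴ * C).trace := Matrix.trace_mul_comm _ _
  have h2 : ((C * Cᴴ) ^ 2).trace = ((Cᴴ * C) ^ 2).trace := by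
    rw [pow_two, pow_two, Matrix.mul_assoc, Matrix.trace_mul_comm]
    simp only [Matrix.mul_assoc]
  -- The squared area is a principal 2×2 minor of `Cᴴ * C`; the minors with `i = j` vanish, so
  -- summing over all ordered pairs is harmless.
  have h3 : ∀ i j, pairArea (colPair C i j) ^ 2 =
      ((Cᴴ * C) i i * (Cᴴ * C) j j - (Cᴴ * C) i j * (Cᴴ * C) j i).re := by
    intro i j
    have : (colPair C i j)ᴴ * colPair C i j = (Cᴴ * C).submatrix ![i, j] ![i, j] := rfl
    rw [pairArea_sq, this, Matrix.det_fin_two]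
    simp
  simp only [h1, h2, h3, ← Complex.re_sum, Finset.sum_sub_distrib]
  congr 2
  · rw [pow_two, Matrix.trace, Finset.sum_mul_sum]
    rfl
  · rw [pow_two, Matrix.trace]
    simp [Matrix.mul_apply]

theorem trace_pow_eq_sum_eigenvalues {ρ : Matrix (Fin d) (Fin d) ℂ} (h : ρ.IsHermitian) (m : ℕ) :
    (ρ ^ m).trace = ((∑ i, h.eigenvalues i ^ m : ℝ) : ℂ) := by
  conv_lhs => rw [h.spectral_theorem]
  rw [← map_pow, Unitary.conjStarAlgAut_apply, Matrix.trace_mul_comm, ← Matrix.mul_assoc]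
  simp [Matrix.diagonal_pow, Matrix.trace_diagonal]

/-- Reduces all moments to the second: Jensen's inequality, with the eigenvalues as both weights and
values, gives `(tr ρ²) ^ (m - 1) ≤ tr ρ ^ m`. The exponent `m` in the statement is weaker but
suffices as `tr ρ²` tends to 1. -/
theorem trace_pow_bounds {ρ : Matrix (Fin d) (Fin d) ℂ} (hρ : IsState ρ) {m : ℕ} (hm : 1 ≤ m) :
    ∃ t : ℝ, (ρ ^ m).trace = t ∧ (ρ ^ 2).trace.re ^ m ≤ t ∧ t ≤ 1 := by
  have hh := hρ.1.isHermitian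
  have h0 := hρ.1.eigenvalues_nonneg
  have h1 : ∑ i, hh.eigenvalues i = 1 := by
    have := hh.trace_eq_sum_eigenvalues
    rw [hρ.2] at this
    exact Complex.ofReal_injective (by simpa using this.symm)
  have hle : ∀ i, hh.eigenvalues i ≤ 1 := fun i => by
    rw [← h1]
    exact Finset.single_le_sum (fun i _ => h0 i) (Finset.mem_univ i)
  obtain ⟨k, rfl⟩ := Nat.exists_eq_add_of_le' hm
  refine ⟨_, trace_pow_eq_sum_eigenvalues hh _, ?_, ?_⟩
  · have h2 : 0 ≤ ∑ i, hh.eigenvalues i ^ 2 := Finset.sum_nonneg fun i _ => sq_nonneg _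
    have h3 : ∑ i, hh.eigenvalues i ^ 2 ≤ 1 := by
      rw [← h1]
      exact Finset.sum_le_sum fun i _ => pow_le_of_le_one (h0 i) (hle i) two_ne_zero
    rw [trace_pow_eq_sum_eigenvalues hh, Complex.ofReal_re]
    calc (∑ i, hh.eigenvalues i ^ 2) ^ (k + 1) ≤ (∑ i, hh.eigenvalues i ^ 2) ^ k :=
          pow_le_pow_of_le_one h2 h3 (Nat.le_succ k)
      _ = (∑ i, hh.eigenvalues i * hh.eigenvalues i) ^ k := by simp only [pow_two]
      _ ≤ ∑ i, hh.eigenvalues i * hh.eigenvalues i ^ k :=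
          Real.pow_arith_mean_le_arith_mean_pow _ _ _ (fun i _ => h0 i) h1 (fun i _ => h0 i) k
      _ = _ := by simp only [pow_succ']
  · rw [← h1]
    exact Finset.sum_le_sum fun i _ => pow_le_of_le_one (h0 i) (hle i) (Nat.succ_ne_zero k)

end Purity

end DisorderedKraus

namespace DisorderedKraus

/-! ### Decay of the total area along an orbit -/

section Dynamics

variable {Ω A : Type*} {d : ℕ}

theorem sum_krausProduct_succ [Fintype A] {M : Type*} [AddCommMonoid M]
    (V : Ω → A → Matrix (Fin d) (Fin d) ℂ) (θ : Ω → Ω) (ω : Ω) (n : ℕ)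
    (f : Matrix (Fin d) (Fin d) ℂ → M) :
    ∑ a, f (krausProduct V θ ω (n + 1) a) =
      ∑ a, ∑ c, f (V (θ^[n + 1] ω) c * krausProduct V θ ω n a) := by
  rw [← (Fin.snocEquiv fun _ : Fin (n + 1) => A).sum_comp, Fintype.sum_prod_type_right]
  simp only [Fin.snocEquiv, Equiv.coe_fn_mk, krausProduct, Fin.snoc_last, Fin.snoc_castSucc]

theorem sum_krausProduct_add [Fintype A] {M : Type*} [AddCommMonoid M]
    (V : Ω → A → Matrix (Fin d) (Fin d) ℂ) (θ : Ω → Ω) (ω : Ω) (n m : ℕ)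
    (f : Matrix (Fin d) (Fin d) ℂ → M) :
    ∑ a, f (krausProduct V θ ω (n + m) a) =
      ∑ a, ∑ b, f (krausProduct V θ (θ^[n] ω) m b * krausProduct V θ ω n a) := by
  induction m generalizing f with
  | zero => simp [krausProduct]
  | succ m ih =>
    have h1 := sum_krausProduct_succ V θ ω (n + m) f
    have h2 := ih fun W => ∑ c, f (V (θ^[n + m + 1] ω) c * W)
    rw [← add_assoc, h1, h2]
    refine Finset.sum_congr rfl fun a _ => ?_
    rw [sum_krausProduct_succ V θ (θ^[n] ω) m fun W => f (W * krausProduct V θ ω n a)]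
    simp only [Matrix.mul_assoc, ← Function.iterate_add_apply, add_assoc, add_comm]

theorem sum_krausProduct_gram [Fintype A] {V : Ω → A → Matrix (Fin d) (Fin d) ℂ} {θ : Ω → Ω}
    {ω : Ω} (hω : ∀ n, ∑ a, (V (θ^[n + 1] ω) a)ᴴ * V (θ^[n + 1] ω) a = 1) (n : ℕ) :
    ∑ a, (krausProduct V θ ω n a)ᴴ * krausProduct V θ ω n a = 1 := by
  induction n with
  | zero => simp [krausProduct]
  | succ n ih =>
    rw [sum_krausProduct_succ V θ ω n fun W => Wᴴ * W, ← ih]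
    refine Finset.sum_congr rfl fun a _ => ?_
    calc _ = (krausProduct V θ ω n a)ᴴ * (∑ c, (V (θ^[n + 1] ω) c)ᴴ * V (θ^[n + 1] ω) c) *
          krausProduct V θ ω n a := by
          simp only [Matrix.conjTranspose_mul, Matrix.mul_assoc, Matrix.sum_mul, Matrix.mul_sum]
      _ = _ := by rw [hω, Matrix.mul_one]

/-- The total area, over all outcomes of `n` measurements, of the images of a pair of vectors. -/
noncomputable def totalArea [Fintype A] (V : Ω → A → Matrix (Fin d) (Fin d) ℂ) (θ : Ω → Ω) (ω : Ω)
    (n : ℕ) (Y : Matrix (Fin d) (Fin 2) ℂ) : ℝ :=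
  ∑ a, pairArea (krausProduct V θ ω n a * Y)

variable [Fintype A] {V : Ω → A → Matrix (Fin d) (Fin d) ℂ} {θ : Ω → Ω} {ω : Ω}

theorem totalArea_nonneg (n : ℕ) (Y : Matrix (Fin d) (Fin 2) ℂ) : 0 ≤ totalArea V θ ω n Y :=
  Finset.sum_nonneg fun _ _ => pairArea_nonneg _

theorem continuous_totalArea (n : ℕ) : Continuous (totalArea V θ ω n) :=
  continuous_finsetSum _ fun _ _ => continuous_pairArea.comp (continuous_const.matrix_mul continuous_id)

theorem totalArea_add (n m : ℕ) (Y : Matrix (Fin d) (Fin 2) ℂ) :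
    totalArea V θ ω (n + m) Y =
      ∑ a, totalArea V θ (θ^[n] ω) m (krausProduct V θ ω n a * Y) := by
  unfold totalArea
  rw [sum_krausProduct_add V θ ω n m fun W => pairArea (W * Y)]
  simp only [Matrix.mul_assoc]

theorem totalArea_antitone (hω : ∀ n, ∑ a, (V (θ^[n + 1] ω) a)ᴴ * V (θ^[n + 1] ω) a = 1)
    (Y : Matrix (Fin d) (Fin 2) ℂ) : Antitone fun n => totalArea V θ ω n Y := by
  refine antitone_nat_of_succ_le fun n => ?_
  unfold totalArea
  rw [sum_krausProduct_succ V θ ω n fun W => pairArea (W * Y)]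
  refine Finset.sum_le_sum fun a _ => ?_
  simp only [Matrix.mul_assoc]
  exact sum_pairArea_le (hω n) _

/-- The nonincreasing total area has a limit `L`. Passing to the limit along the times at which the
next `N` steps contract gives `L ≤ c * L`, so `L = 0`. -/
theorem tendsto_totalArea (hω : ∀ n, ∑ a, (V (θ^[n + 1] ω) a)ᴴ * V (θ^[n + 1] ω) a = 1)
    {N : ℕ} {c : ℝ} (hc : c < 1)
    (h : ∃ᶠ n in atTop, ∀ Y, totalArea V θ (θ^[n] ω) N Y ≤ c * pairArea Y)
    (Y : Matrix (Fin d) (Fin 2) ℂ) : Tendsto (fun n => totalArea V θ ω n Y) atTop (𝓝 0) := by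
  have hlim := tendsto_atTop_ciInf (totalArea_antitone hω Y)
    ⟨0, by rintro _ ⟨n, rfl⟩; exact totalArea_nonneg n Y⟩
  set L := ⨅ n, totalArea V θ ω n Y
  have hL : 0 ≤ L := ge_of_tendsto' hlim fun n => totalArea_nonneg n Y
  have hLc : L ≤ c * L := by
    refine le_of_tendsto_of_tendsto_of_frequently (hlim.comp (tendsto_add_atTop_nat N))
      (hlim.const_mul c) (h.mono fun n hn => ?_)
    simp only [Function.comp_apply]
    rw [totalArea_add]
    calc _ ≤ ∑ a, c * pairArea (krausProduct V θ ω n a * Y) :=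
          Finset.sum_le_sum fun a _ => hn _
      _ = _ := by rw [← Finset.mul_sum]; rfl
  have : L = 0 := by nlinarith
  rwa [this] at hlim

end Dynamics

/-! ### Dark projections and contraction -/

section Dark

variable {Ω A : Type*} {d : ℕ}

theorem isCompact_isometries : IsCompact {X : Matrix (Fin d) (Fin 2) ℂ | Xᴴ * X = 1} := by
  have hclosed : IsClosed {X : Matrix (Fin d) (Fin 2) ℂ | Xᴴ * X = 1} :=
    isClosed_eq (by fun_prop) continuous_const
  refine (isCompact_univ_pi fun i : Fin d => isCompact_univ_pi fun j : Fin 2 =>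
    isCompact_closedBall (0 : ℂ) 1).of_isClosed_subset hclosed
    fun (X : Matrix (Fin d) (Fin 2) ℂ) hX i _ j _ => ?_
  have h : ∑ k, ‖X k j‖ ^ 2 = 1 := by
    have h1 : (Xᴴ * X) j j = 1 := by rw [show Xᴴ * X = 1 from hX, Matrix.one_apply_eq]
    rw [Matrix.mul_apply] at h1
    simp only [Matrix.conjTranspose_apply, Complex.star_def, Complex.conj_mul'] at h1
    exact_mod_cast h1
  rw [mem_closedBall_zero_iff, ← sq_le_one_iff₀ (norm_nonneg _), ← h]
  exact Finset.single_le_sum (f := fun k => ‖X k j‖ ^ 2) (fun k _ => sq_nonneg _)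
    (Finset.mem_univ i)

theorem mem_darkProjections {V : Ω → A → Matrix (Fin d) (Fin d) ℂ} {θ : Ω → Ω} {ω : Ω}
    {p : Matrix (Fin d) (Fin d) ℂ} :
    p ∈ darkProjections V θ ω ↔ IsStarProjection p ∧ 2 ≤ p.rank ∧ ∀ n, ∀ a : Fin n → A,
      ∃ l : ℝ, 0 ≤ l ∧ l ≤ 1 ∧
        p * ((krausProduct V θ ω n a)ᴴ * krausProduct V θ ω n a) * p = (l : ℂ) • p := by
  simp only [darkProjections, grayProjections, Set.mem_iInter, Set.mem_iUnion, Set.mem_Icc,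
    Set.mem_ofPred_eq, exists_prop]
  constructor
  · intro h
    obtain ⟨r, hr, h1, h2, -⟩ := h 0
    refine ⟨h1, h2 ▸ hr.1, fun n => ?_⟩
    obtain ⟨-, -, -, -, h3⟩ := h n
    exact h3
  · rintro ⟨h1, h2, h3⟩ n
    exact ⟨_, ⟨h2, by simpa using p.rank_le_card_width⟩, h1, rfl, h3 n⟩

theorem mul_conjTranspose_mem_darkProjections {V : Ω → A → Matrix (Fin d) (Fin d) ℂ} {θ : Ω → Ω}
    {ω : Ω} {X : Matrix (Fin d) (Fin 2) ℂ} (hX : Xᴴ * X = 1)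
    (h : ∀ n, ∀ a : Fin n → A, ∃ l : ℝ, 0 ≤ l ∧ l ≤ 1 ∧
      (krausProduct V θ ω n a * X)ᴴ * (krausProduct V θ ω n a * X) = (l : ℂ) • 1) :
    X * Xᴴ ∈ darkProjections V θ ω := by
  refine mem_darkProjections.2 ⟨⟨?_, ?_⟩, ?_, fun n a => ?_⟩
  · calc X * Xᴴ * (X * Xᴴ) = X * (Xᴴ * X) * Xᴴ := by simp only [Matrix.mul_assoc]
      _ = X * Xᴴ := by rw [hX, Matrix.mul_one]
  · exact Matrix.isHermitian_mul_conjTranspose_self X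
  · rw [Matrix.rank_self_mul_conjTranspose, ← Matrix.rank_conjTranspose_mul_self, hX]
    simp
  · obtain ⟨l, h0, h1, hl⟩ := h n a
    refine ⟨l, h0, h1, ?_⟩
    calc _ = X * ((krausProduct V θ ω n a * X)ᴴ * (krausProduct V θ ω n a * X)) * Xᴴ := by
          simp only [Matrix.conjTranspose_mul, Matrix.mul_assoc]
      _ = _ := by rw [hl]; simp

/-- Without dark projections, the total area of pairs is contracted after finitely many steps. -/
theorem exists_contraction [Fintype A] {V : Ω → A → Matrix (Fin d) (Fin d) ℂ} {θ : Ω → Ω} {ω : Ω}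
    (hω : ∀ n, ∑ a, (V (θ^[n + 1] ω) a)ᴴ * V (θ^[n + 1] ω) a = 1)
    (hD : darkProjections V θ ω = ∅) :
    ∃ N k : ℕ, ∀ Y, totalArea V θ ω N Y ≤ (1 - 1 / ((k : ℝ) + 1)) * pairArea Y := by
  by_contra! hcon
  -- The orthonormal pairs whose total area has not dropped by time `N`: nested compact sets, whose
  -- common point would span the range of a dark projection.
  let K : ℕ → Set (Matrix (Fin d) (Fin 2) ℂ) := fun N => {X | Xᴴ * X = 1 ∧ 1 ≤ totalArea V θ ω N X}
  have hclosed : ∀ N, IsClosed (K N) := fun N =>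
    isCompact_isometries.isClosed.inter (isClosed_le continuous_const (continuous_totalArea N))
  have hne : ∀ N, (K N).Nonempty := by
    intro N
    by_contra hK
    have hlt : ∀ X : Matrix (Fin d) (Fin 2) ℂ, Xᴴ * X = 1 → totalArea V θ ω N X < 1 := by
      intro X hX
      by_contra h
      exact hK ⟨X, hX, not_lt.1 h⟩
    -- If `K N` were empty, the maximum of the total area over orthonormal pairs would be below 1, a
    -- uniform contraction. When no orthonormal pair exists, any `k` will do.
    obtain ⟨k, hk⟩ : ∃ k : ℕ, ∀ X : Matrix (Fin d) (Fin 2) ℂ, Xᴴ * X = 1 →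
        totalArea V θ ω N X ≤ 1 - 1 / ((k : ℝ) + 1) := by
      rcases Set.eq_empty_or_nonempty {X : Matrix (Fin d) (Fin 2) ℂ | Xᴴ * X = 1} with he | he
      · exact ⟨0, fun X hX => (Set.eq_empty_iff_forall_notMem.1 he X hX).elim⟩
      · obtain ⟨X₀, hX₀, hmax⟩ :=
          isCompact_isometries.exists_isMaxOn he
            (continuous_totalArea (V := V) (θ := θ) (ω := ω) N).continuousOn
        obtain ⟨k, hk⟩ := exists_nat_one_div_lt (sub_pos.2 (hlt X₀ hX₀))
        exact ⟨k, fun X hX => (hmax hX).trans (by linarith)⟩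
    obtain ⟨Y, hY⟩ := hcon N k
    exact absurd (sum_pairArea_le_of_isometry (W := krausProduct V θ ω N) hk Y) (not_le.2 hY)
  obtain ⟨X, hX⟩ := IsCompact.nonempty_iInter_of_sequence_nonempty_isCompact_isClosed K
    (fun N X hX => ⟨hX.1, hX.2.trans (totalArea_antitone hω X N.le_succ)⟩) hne
    (isCompact_isometries.of_isClosed_subset (hclosed 0) fun X hX => hX.1) hclosed
  rw [Set.mem_iInter] at hX
  exact Set.eq_empty_iff_forall_notMem.1 hD _ (mul_conjTranspose_mem_darkProjections (hX 0).1
    fun n => exists_gram_eq_smul_one (sum_krausProduct_gram hω n) (hX 0).1 (hX n).2)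

end Dark

/-! ### Measurability, recurrence and the ergodic argument -/

section Recurrence

variable {Ω A : Type*} {d : ℕ} [MeasurableSpace Ω]

theorem measurable_continuous_comp_matrix {m n : ℕ} {M : Ω → Matrix (Fin m) (Fin n) ℂ}
    (hM : ∀ i j, Measurable fun ω => M ω i j) {f : Matrix (Fin m) (Fin n) ℂ → ℝ}
    (hf : Continuous f) : Measurable fun ω => f (M ω) := by
  have h1 : Measurable (fun ω i j => M ω i j : Ω → Fin m → Fin n → ℂ) :=
    measurable_pi_iff.2 fun i => measurable_pi_iff.2 fun j => hM i j
  have h2 : Continuous (fun M => f M : (Fin m → Fin n → ℂ) → ℝ) := hf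
  exact h2.measurable.comp h1

theorem measurable_krausProduct {V : Ω → A → Matrix (Fin d) (Fin d) ℂ} {θ : Ω → Ω}
    (hV : ∀ a i j, Measurable fun ω => V ω a i j) (hθ : Measurable θ) (n : ℕ) (a : Fin n → A)
    (i j : Fin d) : Measurable fun ω => krausProduct V θ ω n a i j := by
  induction n generalizing i j with
  | zero => exact measurable_const
  | succ n ih =>
    simp only [krausProduct, Matrix.mul_apply]
    exact Finset.measurable_fun_sum _ fun k _ =>
      ((hV _ _ _).comp (hθ.iterate (n + 1))).mul (ih _ _ _)

/-- Both sides are continuous in `Y`, so countably many `Y` suffice. -/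
theorem measurableSet_contraction [Fintype A] {V : Ω → A → Matrix (Fin d) (Fin d) ℂ} {θ : Ω → Ω}
    (hV : ∀ a i j, Measurable fun ω => V ω a i j) (hθ : Measurable θ) (N : ℕ) (c : ℝ) :
    MeasurableSet {ω | ∀ Y, totalArea V θ ω N Y ≤ c * pairArea Y} := by
  have : SecondCountableTopology (Matrix (Fin d) (Fin 2) ℂ) :=
    inferInstanceAs (SecondCountableTopology (Fin d → Fin 2 → ℂ))
  obtain ⟨s, hs, hd⟩ := TopologicalSpace.exists_countable_dense (Matrix (Fin d) (Fin 2) ℂ)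
  have : {ω | ∀ Y, totalArea V θ ω N Y ≤ c * pairArea Y} =
      ⋂ Y ∈ s, {ω | totalArea V θ ω N Y ≤ c * pairArea Y} := by
    ext ω
    simp only [Set.mem_ofPred_eq, Set.mem_iInter]
    refine ⟨fun h Y _ => h Y, fun h Y => ?_⟩
    have hcl : IsClosed {Y | totalArea V θ ω N Y ≤ c * pairArea Y} :=
      isClosed_le (continuous_totalArea N) (continuous_const.mul continuous_pairArea)
    exact hcl.closure_subset_iff.2 h (hd Y)
  rw [this]
  refine MeasurableSet.biInter hs fun Y _ => measurableSet_le ?_ measurable_const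
  exact Finset.measurable_fun_sum _ fun a _ =>
    measurable_continuous_comp_matrix (measurable_krausProduct hV hθ N a)
      (continuous_pairArea.comp (continuous_id.matrix_mul continuous_const))

/-- An ergodic probability-preserving map visits every set of positive measure infinitely often. -/
theorem ae_frequently_mem {P : Measure Ω} [IsProbabilityMeasure P] {θ : Ω → Ω}
    (hθ : Ergodic θ P) {E : Set Ω} (hE : MeasurableSet E) (hpos : P E ≠ 0) :
    ∀ᵐ ω ∂P, ∃ᶠ n in atTop, θ^[n] ω ∈ E := by
  have hmeas : MeasurableSet {ω | ∃ᶠ n in atTop, θ^[n] ω ∈ E} := by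
    simp only [frequently_atTop, Set.ofPred_forall, Set.ofPred_exists, Set.ofPred_and]
    exact MeasurableSet.iInter fun i => MeasurableSet.iUnion fun n =>
      (MeasurableSet.const _).inter (hθ.measurable.iterate n hE)
  have hinv : θ ⁻¹' {ω | ∃ᶠ n in atTop, θ^[n] ω ∈ E} = {ω | ∃ᶠ n in atTop, θ^[n] ω ∈ E} := by
    ext ω
    conv_rhs => rw [Set.mem_ofPred_eq, ← map_add_atTop_eq_nat 1, frequently_map]
    simp [Function.iterate_succ_apply]
  -- Visiting `E` infinitely often is an invariant event, hence null or full; it is not null,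
  -- because Poincaré recurrence puts almost every point of `E` in it.
  rcases hθ.toPreErgodic.ae_mem_or_ae_notMem hmeas hinv with h | h
  · exact h
  · refine absurd (measure_eq_zero_iff_ae_notMem.2 ?_) hpos
    filter_upwards [h, hθ.toMeasurePreserving.conservative.ae_mem_imp_frequently_image_mem
      hE.nullMeasurableSet] with ω h1 h2 h3
    exact h1 (h2 h3)

theorem ae_kraus_orbit [Fintype A] {P : Measure Ω} {V : Ω → A → Matrix (Fin d) (Fin d) ℂ}
    {θ : Ω → Ω} (hθ : MeasurePreserving θ P P) (hV : IsPerfectKrausEnsemble P V) :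
    ∀ᵐ ω ∂P, ∀ n, ∑ a, (V (θ^[n + 1] ω) a)ᴴ * V (θ^[n + 1] ω) a = 1 :=
  ae_all_iff.2 fun n => (hθ.iterate (n + 1)).quasiMeasurePreserving.ae hV.sum_eq_one

theorem ae_tendsto_totalArea [Fintype A] {P : Measure Ω} [IsProbabilityMeasure P]
    {V : Ω → A → Matrix (Fin d) (Fin d) ℂ} {θ : Ω → Ω} (hθ : Ergodic θ P)
    (hV : IsPerfectKrausEnsemble P V) (hD : 0 < P {ω | darkProjections V θ ω = ∅}) :
    ∀ᵐ ω ∂P, ∀ Y, Tendsto (fun n => totalArea V θ ω n Y) atTop (𝓝 0) := by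
  have horb := ae_kraus_orbit hθ.toMeasurePreserving hV
  -- The contraction events are indexed by two naturals, so some single one has positive
  -- probability.
  obtain ⟨N, k, hNk⟩ : ∃ N k : ℕ,
      P {ω | ∀ Y, totalArea V θ ω N Y ≤ (1 - 1 / ((k : ℝ) + 1)) * pairArea Y} ≠ 0 := by
    by_contra! h0
    refine hD.ne' (measure_eq_zero_iff_ae_notMem.2 ?_)
    have h0' := ae_all_iff.2 fun N => ae_all_iff.2 fun k => measure_eq_zero_iff_ae_notMem.1 (h0 N k)
    filter_upwards [horb, h0'] with ω h1 h2 h3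
    obtain ⟨N, k, h⟩ := exists_contraction h1 h3
    exact h2 N k h
  filter_upwards [horb, ae_frequently_mem hθ
    (measurableSet_contraction hV.measurable hθ.measurable N _) hNk] with ω h1 h2
  exact tendsto_totalArea h1 (sub_lt_self 1 (by positivity)) h2

end Recurrence

end DisorderedKraus

namespace DisorderedKraus

/-! ### A maximal inequality on the space of outcomes -/

section Maximal

variable {A : Type*} [MeasurableSpace A]

/-- Maximal inequality for nonnegative supermartingales on `A^ℕ`, written as the ratio of a
superadditive weight `z` and the cylinder masses of `μ`. -/
theorem mul_measure_cyl_inter_le [Fintype A] (μ : Measure (ℕ → A)) (z : ∀ n, (Fin n → A) → ℝ≥0∞)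
    (hz : ∀ n b, ∑ c, z (n + 1) (Fin.snoc b c) ≤ z n b) (ε : ℝ≥0∞) (k n : ℕ) (b : Fin n → A) :
    ε * μ (cyl n b ∩ {a | ∃ m, n ≤ m ∧ m ≤ n + k ∧
      ε * μ (cyl m fun i => a i) ≤ z m fun i => a i}) ≤ z n b := by
  induction k generalizing n with
  | zero =>
    by_cases h : ε * μ (cyl n b) ≤ z n b
    · exact (mul_le_mul_right (measure_mono Set.inter_subset_left) _).trans h
    · rw [Set.eq_empty_of_forall_notMem (s := _ ∩ _)]
      · simp
      · rintro a ⟨ha, m, h1, h2, h3⟩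
        obtain rfl : n = m := by omega
        have : (fun i : Fin n => a i) = b := funext ha
        rw [this] at h3
        exact h h3
  | succ k ih =>
    -- A stopping argument: if the threshold is already reached at `b`, the whole cylinder is paid
    -- for by `z n b`; otherwise it is reached strictly later, and one splits according to the next
    -- outcome.
    by_cases h : ε * μ (cyl n b) ≤ z n b
    · exact (mul_le_mul_right (measure_mono Set.inter_subset_left) _).trans h
    · refine le_trans ?_ (hz n b)
      refine le_trans ?_ (Finset.sum_le_sum fun c _ => ih (n + 1) (Fin.snoc b c))
      rw [← Finset.mul_sum]
      gcongr
      refine (measure_mono ?_).trans (measure_iUnion_fintype_le μ _)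
      rintro a ⟨ha, m, h1, h2, h3⟩
      refine Set.mem_iUnion.2 ⟨a n, fun i => ?_, m, ?_, by omega, h3⟩
      · refine Fin.lastCases ?_ (fun j => ?_) i
        · simp
        · simpa using ha j
      · rcases h1.eq_or_lt with rfl | h1
        · have : (fun i : Fin n => a i) = b := funext ha
          rw [this] at h3
          exact absurd h3 h
        · exact h1

theorem mul_measure_exists_le [Fintype A] (μ : Measure (ℕ → A)) (z : ∀ n, (Fin n → A) → ℝ≥0∞)
    (hz : ∀ n b, ∑ c, z (n + 1) (Fin.snoc b c) ≤ z n b) (ε : ℝ≥0∞) (n : ℕ) :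
    ε * μ {a | ∃ m, n ≤ m ∧ ε * μ (cyl m fun i => a i) ≤ z m fun i => a i} ≤ ∑ b, z n b := by
  let B : ℕ → Set (ℕ → A) := fun k =>
    {a | ∃ m, n ≤ m ∧ m ≤ n + k ∧ ε * μ (cyl m fun i => a i) ≤ z m fun i => a i}
  have hB : {a | ∃ m, n ≤ m ∧ ε * μ (cyl m fun i => a i) ≤ z m fun i => a i} = ⋃ k, B k := by
    ext a
    simp only [B, Set.mem_iUnion, Set.mem_ofPred_eq]
    constructor
    · rintro ⟨m, h1, h2⟩
      exact ⟨m, m, h1, by omega, h2⟩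
    · rintro ⟨k, m, h1, -, h2⟩
      exact ⟨m, h1, h2⟩
  have hmono : Monotone B := by
    rintro k l hkl a ⟨m, h1, h2, h3⟩
    exact ⟨m, h1, by omega, h3⟩
  rw [hB, hmono.measure_iUnion, ENNReal.mul_iSup]
  refine iSup_le fun k => ?_
  refine le_trans ?_ (Finset.sum_le_sum fun b _ => mul_measure_cyl_inter_le μ z hz ε k n b)
  rw [← Finset.mul_sum]
  gcongr
  refine (measure_mono ?_).trans (measure_iUnion_fintype_le μ _)
  exact fun a ha => Set.mem_iUnion.2 ⟨fun i => a i, fun i => rfl, ha⟩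

/-- The failure event lies in each event "the threshold is reached after time `n`", whose mass is at
most the total weight at time `n` divided by `ε`. Multiplying out the ratio avoids dividing by null
cylinders. -/
theorem ae_eventually_lt_mul_measure_cyl [Fintype A] (μ : Measure (ℕ → A))
    (z : ∀ n, (Fin n → A) → ℝ≥0∞) (hz : ∀ n b, ∑ c, z (n + 1) (Fin.snoc b c) ≤ z n b)
    (hlim : Tendsto (fun n => ∑ b, z n b) atTop (𝓝 0)) {ε : ℝ≥0∞} (hε : ε ≠ 0) :
    ∀ᵐ a ∂μ, ∀ᶠ m in atTop, z m (fun i => a i) < ε * μ (cyl m fun i => a i) := by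
  have h0 : ε * μ {a | ¬ ∀ᶠ m in atTop, z m (fun i => a i) < ε * μ (cyl m fun i => a i)} ≤ 0 := by
    refine ge_of_tendsto' hlim fun n => le_trans ?_ (mul_measure_exists_le μ z hz ε n)
    gcongr
    intro h
    simp only [eventually_atTop, not_exists, not_forall, not_lt] at h
    obtain ⟨m, h1, h2⟩ := h n
    exact ⟨m, h1, h2⟩
  rw [ae_iff]
  simpa [hε] using h0

theorem ae_measure_cyl_ne_zero [Finite A] (μ : Measure (ℕ → A)) :
    ∀ᵐ a ∂μ, ∀ n, μ (cyl n fun i => a i) ≠ 0 := by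
  refine ae_all_iff.2 fun n => ?_
  rw [ae_iff]
  refine measure_mono_null (t := ⋃ b ∈ {b : Fin n → A | μ (cyl n b) = 0}, cyl n b) ?_
    ((measure_biUnion_null_iff (Set.to_countable _)).2 fun b hb => hb)
  intro a ha
  simp only [Set.mem_iUnion]
  exact ⟨fun i => a i, not_not.1 ha, fun i => rfl⟩

end Maximal

/-! ### Purification with vanishing areas, and its failure on dark projections -/

section Purification

variable {Ω A : Type*} {d : ℕ} {V : Ω → A → Matrix (Fin d) (Fin d) ℂ} {θ : Ω → Ω} {ω : Ω}

theorem trace_kraus_eq {ϱ : Matrix (Fin d) (Fin d) ℂ} (hϱ : ϱ.PosSemidef)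
    (W : Matrix (Fin d) (Fin d) ℂ) :
    (W * ϱ * Wᴴ).trace = ((W * ϱ * Wᴴ).trace.re : ℂ) :=
  Complex.ext rfl (by
    simpa using (Complex.le_def.1 (hϱ.mul_mul_conjTranspose_same W).trace_nonneg).2.symm)

/-- The trajectory is a state, with purity controlled by the total area of pairs of columns. -/
theorem isState_trajectory {B : Matrix (Fin d) (Fin d) ℂ} {e : ℝ} {n : ℕ} {a : ℕ → A}
    (h : ∑ i, ∑ j, pairArea (krausProduct V θ ω n (fun i => a i) * colPair B i j) <
      e * outcomeWeight V θ (B * Bᴴ) ω n (fun i => a i)) :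
    IsState (trajectory V θ (B * Bᴴ) ω n a) ∧
      1 - e ^ 2 ≤ (trajectory V θ (B * Bᴴ) ω n a ^ 2).trace.re := by
  have hB := Matrix.posSemidef_self_mul_conjTranspose B
  unfold trajectory
  unfold outcomeWeight at h
  dsimp only
  set W := krausProduct V θ ω n (fun i => a i)
  have htr := trace_kraus_eq hB W
  have hpsd := hB.mul_mul_conjTranspose_same W
  have hw0 : 0 ≤ (W * (B * Bᴴ) * Wᴴ).trace.re := (Complex.le_def.1 hpsd.trace_nonneg).1
  have hdef := trace_sq_sub_trace_sq (W * B)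
  have hσ : W * B * (W * B)ᴴ = W * (B * Bᴴ) * Wᴴ := by
    simp only [Matrix.conjTranspose_mul, Matrix.mul_assoc]
  rw [hσ] at hdef
  simp only [mul_colPair] at h
  set σ := W * (B * Bᴴ) * Wᴴ
  set w := σ.trace.re
  have hZ0 : 0 ≤ ∑ i, ∑ j, pairArea (colPair (W * B) i j) :=
    Finset.sum_nonneg fun _ _ => Finset.sum_nonneg fun _ _ => pairArea_nonneg _
  -- The strict inequality `h` against a nonnegative area already excludes outcomes of weight zero.
  have hw : 0 < w := by
    refine hw0.lt_of_ne fun h0 => ?_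
    rw [← h0, mul_zero] at h
    exact absurd hZ0 (not_le.2 h)
  have hwC : (w : ℂ) ≠ 0 := by exact_mod_cast hw.ne'
  have hZ : ∑ i, ∑ j, pairArea (colPair (W * B) i j) ^ 2 ≤ e ^ 2 * w ^ 2 := by
    calc _ ≤ (∑ i, ∑ j, pairArea (colPair (W * B) i j)) ^ 2 := by
          rw [← Fintype.sum_prod_type', ← Fintype.sum_prod_type']
          exact Finset.sum_sq_le_sq_sum_of_nonneg fun _ _ => pairArea_nonneg _
      _ ≤ (e * w) ^ 2 := pow_le_pow_left₀ hZ0 h.le 2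
      _ = _ := by ring
  rw [htr]
  refine ⟨⟨?_, ?_⟩, ?_⟩
  · refine hpsd.smul ?_
    rw [← Complex.ofReal_inv]
    exact_mod_cast (inv_nonneg.2 hw0)
  · rw [Matrix.trace_smul, htr, smul_eq_mul, inv_mul_cancel₀ hwC]
  · rw [smul_pow, Matrix.trace_smul, smul_eq_mul, ← Complex.ofReal_inv, ← Complex.ofReal_pow,
      Complex.re_ofReal_mul]
    rw [← hdef, htr, Complex.sub_re, ← Complex.ofReal_pow, Complex.ofReal_re] at hZ
    rw [inv_pow, inv_mul_eq_div, le_div_iff₀ (by positivity)]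
    linarith

open scoped MatrixOrder in
theorem mem_purificationEvent [Fintype A] [MeasurableSpace A] [DiscreteMeasurableSpace A]
    (hω : ∀ n, ∑ a, (V (θ^[n + 1] ω) a)ᴴ * V (θ^[n + 1] ω) a = 1)
    (hlim : ∀ Y, Tendsto (fun n => totalArea V θ ω n Y) atTop (𝓝 0)) :
    ω ∈ purificationEvent V θ := by
  intro ϱ hϱ
  obtain ⟨-, hμ⟩ := isQuantumProbability_quantumProbability V θ ϱ hϱ ω hω
  obtain ⟨B, rfl⟩ := CStarAlgebra.nonneg_iff_eq_mul_star_self.mp hϱ.1.nonneg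
  rw [Matrix.star_eq_conjTranspose] at *
  set μ := quantumProbability V θ (B * Bᴴ) ω
  let z : ∀ n, (Fin n → A) → ℝ := fun n b =>
    ∑ i, ∑ j, pairArea (krausProduct V θ ω n b * colPair B i j)
  have hz0 : ∀ n b, 0 ≤ z n b := fun n b =>
    Finset.sum_nonneg fun _ _ => Finset.sum_nonneg fun _ _ => pairArea_nonneg _
  have hz : ∀ n b, ∑ c, z (n + 1) (Fin.snoc b c) ≤ z n b := by
    intro n b
    simp only [z, krausProduct, Fin.snoc_last, Fin.snoc_castSucc]
    rw [Finset.sum_comm]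
    refine Finset.sum_le_sum fun i _ => ?_
    rw [Finset.sum_comm]
    refine Finset.sum_le_sum fun j _ => ?_
    simp only [Matrix.mul_assoc]
    exact sum_pairArea_le (hω n) _
  have hzlim : Tendsto (fun n => ∑ b, z n b) atTop (𝓝 0) := by
    have h1 : ∀ n, ∑ b, z n b = ∑ i, ∑ j, totalArea V θ ω n (colPair B i j) := by
      intro n
      simp only [z, totalArea]
      rw [Finset.sum_comm]
      exact Finset.sum_congr rfl fun i _ => Finset.sum_comm
    simp only [h1]
    simpa using tendsto_finsetSum (Finset.univ : Finset (Fin d)) fun i _ =>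
      tendsto_finsetSum (Finset.univ : Finset (Fin d)) fun j _ => hlim (colPair B i j)
  have hae : ∀ k : ℕ, ∀ᵐ a ∂μ, ∀ᶠ n in atTop,
      z n (fun i => a i) < 1 / ((k : ℝ) + 1) * outcomeWeight V θ (B * Bᴴ) ω n (fun i => a i) := by
    intro k
    have he : 0 < 1 / ((k : ℝ) + 1) := by positivity
    have := ae_eventually_lt_mul_measure_cyl μ (fun n b => ENNReal.ofReal (z n b)) (fun n b => by
        rw [← ENNReal.ofReal_sum_of_nonneg fun c _ => hz0 _ _]
        exact ENNReal.ofReal_le_ofReal (hz n b)) (by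
        simp only [← ENNReal.ofReal_sum_of_nonneg fun c _ => hz0 _ c]
        simpa using ENNReal.tendsto_ofReal hzlim)
      (ε := ENNReal.ofReal (1 / ((k : ℝ) + 1))) (by simpa using he)
    filter_upwards [this] with a ha
    filter_upwards [ha] with n hn
    rw [hμ, ← ENNReal.ofReal_mul he.le] at hn
    exact (ENNReal.ofReal_lt_ofReal_iff'.1 hn).1
  filter_upwards [ae_all_iff.2 hae] with a ha m hm
  -- Any threshold would do here; only the positivity of the outcome weight matters.
  have hstate : ∀ᶠ n in atTop, IsState (trajectory V θ (B * Bᴴ) ω n a) := by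
    filter_upwards [ha 0] with n hn
    exact (isState_trajectory hn).1
  have hpur : Tendsto (fun n => (trajectory V θ (B * Bᴴ) ω n a ^ 2).trace.re) atTop (𝓝 1) := by
    refine tendsto_order.2 ⟨fun x hx => ?_, fun x hx => ?_⟩
    · obtain ⟨k, hk⟩ := exists_nat_one_div_lt (sub_pos.2 hx)
      filter_upwards [ha k] with n hn
      have h1 := (isState_trajectory hn).2
      have h2 : (1 / ((k : ℝ) + 1)) ^ 2 ≤ 1 / ((k : ℝ) + 1) := by
        refine pow_le_of_le_one (by positivity) ?_ two_ne_zero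
        rw [div_le_one (by positivity)]
        simp
      linarith
    · filter_upwards [hstate] with n hn
      obtain ⟨t, h1, -, h2⟩ := trace_pow_bounds hn one_le_two
      rw [h1, Complex.ofReal_re]
      exact h2.trans_lt hx
  have hre : Tendsto (fun n => (((trajectory V θ (B * Bᴴ) ω n a ^ m).trace.re : ℝ) : ℂ))
      atTop (𝓝 ((1 : ℝ) : ℂ)) := by
    refine (Complex.continuous_ofReal.tendsto 1).comp ?_
    refine tendsto_of_tendsto_of_tendsto_of_le_of_le' (by simpa using hpur.pow m)
      tendsto_const_nhds ?_ ?_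
    all_goals
      filter_upwards [hstate] with n hn
      obtain ⟨t, h1, h2, h3⟩ := trace_pow_bounds hn hm
      rw [h1, Complex.ofReal_re]
      assumption
  rw [Complex.ofReal_one] at hre
  refine hre.congr' ?_
  filter_upwards [hstate] with n hn
  obtain ⟨t, h1, -, -⟩ := trace_pow_bounds hn hm
  rw [h1, Complex.ofReal_re]

theorem trace_eq_rank {p : Matrix (Fin d) (Fin d) ℂ} (hp : p * p = p) : p.trace = p.rank := by
  have h : IsIdempotentElem (Matrix.toLin' p) := by
    rw [IsIdempotentElem, Module.End.mul_eq_comp, ← Matrix.toLin'_mul, hp]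
  rw [← Matrix.trace_toLin'_eq, (LinearMap.IsIdempotentElem.isProj_range _ h).trace]
  rfl

/-- The uniform state on a dark projection never becomes purer. -/
theorem notMem_purificationEvent [Fintype A] [MeasurableSpace A] [DiscreteMeasurableSpace A]
    (hω : ∀ n, ∑ a, (V (θ^[n + 1] ω) a)ᴴ * V (θ^[n + 1] ω) a = 1)
    {p : Matrix (Fin d) (Fin d) ℂ} (hp : p ∈ darkProjections V θ ω) :
    ω ∉ purificationEvent V θ := by
  intro hmem
  obtain ⟨⟨hid, hsa⟩, hr, hdark⟩ := mem_darkProjections.1 hp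
  have hid : p * p = p := hid
  have hsa : pᴴ = p := hsa
  have htr := trace_eq_rank hid
  set r := p.rank
  have hr0 : (r : ℂ) ≠ 0 := by
    have : r ≠ 0 := by omega
    exact_mod_cast this
  have hpsd : p.PosSemidef := by
    have := Matrix.posSemidef_self_mul_conjTranspose p
    rwa [hsa, hid] at this
  have hϱ : IsState ((r : ℂ)⁻¹ • p) := by
    refine ⟨hpsd.smul (by simp), ?_⟩
    rw [Matrix.trace_smul, htr, smul_eq_mul, inv_mul_cancel₀ hr0]
  obtain ⟨hprob, hμ⟩ := isQuantumProbability_quantumProbability V θ _ hϱ ω hω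
  -- As the law is a probability measure, some outcome sequence purifies and has all its cylinders
  -- of positive mass; the latter makes the scalar `l` nonzero at every time.
  obtain ⟨a, ha, hne⟩ := ((hmem _ hϱ).and (ae_measure_cyl_ne_zero _)).exists
  have hconst : ∀ n, (trajectory V θ ((r : ℂ)⁻¹ • p) ω n a ^ 2).trace = (r : ℂ)⁻¹ := by
    intro n
    have hpos := hne n
    rw [hμ, ENNReal.ofReal_ne_zero_iff, outcomeWeight] at hpos
    obtain ⟨l, -, -, hl⟩ := hdark n fun i => a i
    unfold trajectory
    dsimp only
    set W := krausProduct V θ ω n (fun i => a i)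
    have h1 : (W * p * Wᴴ).trace = l * r := by
      calc (W * p * Wᴴ).trace = (W * (p * p) * Wᴴ).trace := by rw [hid]
        _ = (W * p * (p * Wᴴ)).trace := by simp only [Matrix.mul_assoc]
        _ = (p * (Wᴴ * W) * p).trace := by
            rw [Matrix.trace_mul_comm]; simp only [Matrix.mul_assoc]
        _ = l * r := by rw [hl, Matrix.trace_smul, htr, smul_eq_mul]
    -- Thus `W * p * Wᴴ` is `l` times a projection of trace `r`.
    have h2 : (W * p * Wᴴ) ^ 2 = (l : ℂ) • (W * p * Wᴴ) := by
      calc (W * p * Wᴴ) ^ 2 = W * (p * (Wᴴ * W) * p) * Wᴴ := by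
            rw [pow_two]; simp only [Matrix.mul_assoc]
        _ = _ := by rw [hl]; simp
    have h3 : (W * ((r : ℂ)⁻¹ • p) * Wᴴ) = (r : ℂ)⁻¹ • (W * p * Wᴴ) := by simp
    have h4 : (W * ((r : ℂ)⁻¹ • p) * Wᴴ).trace = l := by
      rw [h3, Matrix.trace_smul, h1, smul_eq_mul]
      field_simp
    have hl0 : (l : ℂ) ≠ 0 := by
      intro h
      rw [h4, h] at hpos
      simp at hpos
    rw [h4, h3, smul_pow, smul_pow, h2, Matrix.trace_smul, Matrix.trace_smul, Matrix.trace_smul, h1]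
    simp only [smul_eq_mul]
    field_simp
  have hlim := ha 2 one_le_two
  simp only [hconst] at hlim
  have h1 := tendsto_nhds_unique hlim tendsto_const_nhds
  have h1' : r = 1 := by exact_mod_cast inv_eq_one.1 h1.symm
  omega

end Purification

end DisorderedKraus

namespace DisorderedKraus

/-! ### Random compact sets -/

section RandomSet

variable {Ω E : Type*} [MeasurableSpace Ω] [TopologicalSpace E]

/-- The event that countably many Carathéodory functions have a common zero in a compact set is
measurable. -/
theorem measurableSet_exists_common_zero [T2Space E] [SecondCountableTopology E] {K : Set E}
    (hK : IsCompact K) {f : ℕ → Ω → E → ℝ} (hc : ∀ k ω, Continuous (f k ω))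
    (hm : ∀ k x, Measurable fun ω => f k ω x) (h0 : ∀ k ω x, 0 ≤ f k ω x) :
    MeasurableSet {ω | ∃ x ∈ K, ∀ k, f k ω x = 0} := by
  obtain ⟨s, hs, hd⟩ := TopologicalSpace.exists_countable_dense K
  -- By continuity and compactness, a common zero exists exactly when, for every `j`, some point of
  -- a countable dense set makes the first `j` functions smaller than `1 / (j + 1)`.
  have : {ω | ∃ x ∈ K, ∀ k, f k ω x = 0} =
      ⋂ j : ℕ, ⋃ x ∈ s, ⋂ k ∈ Finset.range j, {ω | f k ω x < 1 / ((j : ℝ) + 1)} := by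
    ext ω
    simp only [Set.mem_iInter, Set.mem_iUnion, Set.mem_ofPred_eq, exists_prop]
    constructor
    · rintro ⟨x, hx, hz⟩ j
      have hopen : IsOpen (⋂ k ∈ Finset.range j, {y : K | f k ω y < 1 / ((j : ℝ) + 1)}) :=
        isOpen_biInter_finset fun k _ =>
          isOpen_lt ((hc k ω).comp continuous_subtype_val) continuous_const
      obtain ⟨y, hys, hy⟩ := hd.exists_mem_open hopen ⟨⟨x, hx⟩, by
        simp only [Set.mem_iInter, Set.mem_ofPred_eq, hz]
        exact fun _ _ => by positivity⟩
      refine ⟨y, hys, ?_⟩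
      simpa only [Set.mem_iInter, Set.mem_ofPred_eq] using hy
    · intro h
      let C : ℕ → Set E := fun j => K ∩ ⋂ k ∈ Finset.range j, {x | f k ω x ≤ 1 / ((j : ℝ) + 1)}
      have hcl : ∀ j, IsClosed (C j) := fun j => hK.isClosed.inter
        (isClosed_biInter fun k _ => isClosed_le (hc k ω) continuous_const)
      have hanti : ∀ j, C (j + 1) ⊆ C j := by
        intro j x hx
        refine ⟨hx.1, Set.mem_iInter₂.2 fun k hk => ?_⟩
        have h1 : f k ω x ≤ 1 / (((j + 1 : ℕ) : ℝ) + 1) := Set.mem_iInter₂.1 hx.2 k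
          (Finset.mem_range.2 ((Finset.mem_range.1 hk).trans j.lt_succ_self))
        refine h1.trans (one_div_le_one_div_of_le (by positivity) ?_)
        push_cast
        linarith
      have hne : ∀ j, (C j).Nonempty := by
        intro j
        obtain ⟨y, -, hy⟩ := h j
        exact ⟨y, y.2, Set.mem_iInter₂.2 fun k hk => (hy k hk).le⟩
      obtain ⟨x, hx⟩ := IsCompact.nonempty_iInter_of_sequence_nonempty_isCompact_isClosed C
        hanti hne (hK.of_isClosed_subset (hcl 0) Set.inter_subset_left) hcl
      rw [Set.mem_iInter] at hx
      refine ⟨x, (hx 0).1, fun k => le_antisymm ?_ (h0 k ω x)⟩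
      refine ge_of_tendsto tendsto_one_div_add_atTop_nhds_zero_nat ?_
      filter_upwards [eventually_gt_atTop k] with j hj
      exact Set.mem_iInter₂.1 (hx j).2 k (Finset.mem_range.2 hj)
  rw [this]
  exact MeasurableSet.iInter fun j => MeasurableSet.biUnion hs fun x _ =>
    Finset.measurableSet_biInter _ fun k _ => measurableSet_lt (hm k x) measurable_const

/-- Compact subsets of a fixed compact set that hit every compact set measurably form a random
compact set. -/
theorem isRandomCompactSet_of_hit [TopologicalSpace.MetrizableSpace E] [SecondCountableTopology E]
    {D : Ω → Set E} {S : Set E} (hS : IsCompact S) (hDS : ∀ ω, D ω ⊆ S)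
    (hD : ∀ ω, IsCompact (D ω))
    (hhit : ∀ K : Set E, IsCompact K → MeasurableSet {ω | (D ω ∩ K).Nonempty}) :
    IsRandomCompactSet D := by
  refine ⟨fun ω => ⟨D ω, hD ω⟩, fun ω => rfl, ?_⟩
  rw [borel_eq_generateFrom_of_subbasis (α := TopologicalSpace.Compacts E) induced_generateFrom_eq]
  refine @measurable_generateFrom _ _ _ _ _ ?_
  rintro _ ⟨_, ⟨U, hU, rfl⟩ | ⟨U, hU, rfl⟩, rfl⟩
  -- First kind of subbasic Vietoris set: lying in `U` means missing the compact set `S ∩ Uᶜ`.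
  · have : {ω | D ω ⊆ U} = {ω | (D ω ∩ (S ∩ Uᶜ)).Nonempty}ᶜ := by
      ext ω
      rw [Set.mem_compl_iff, Set.mem_ofPred_eq, Set.mem_ofPred_eq, Set.not_nonempty_iff_eq_empty,
        ← Set.inter_assoc, Set.inter_eq_left.2 (hDS ω), ← Set.sdiff_eq, Set.sdiff_eq_empty]
    change MeasurableSet {ω | D ω ⊆ U}
    rw [this]
    exact (hhit _ (hS.inter_right (IsOpen.isClosed_compl hU))).compl
  · let _ := TopologicalSpace.metrizableSpaceMetric E
    -- Second kind: an open set is a countable union of closed sets, so hitting `U` means hitting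
    -- some compact `S ∩ F n`.
    obtain ⟨F, hF, -, hFU, -⟩ := IsOpen.exists_iUnion_isClosed (U := U) hU
    have : {ω | (D ω ∩ U).Nonempty} = ⋃ n, {ω | (D ω ∩ (S ∩ F n)).Nonempty} := by
      ext ω
      rw [Set.mem_iUnion, Set.mem_ofPred_eq]
      simp only [Set.mem_ofPred_eq]
      rw [← Set.nonempty_iUnion, ← Set.inter_iUnion, ← Set.inter_iUnion, hFU, ← Set.inter_assoc,
        Set.inter_eq_left.2 (hDS ω)]
    change MeasurableSet {ω | (D ω ∩ U).Nonempty}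
    rw [this]
    exact MeasurableSet.iUnion fun n => hhit _ (hS.inter_right (hF n))

end RandomSet

/-! ### The dark projections as a random compact set -/

section DarkRandom

variable {Ω A : Type*} {d : ℕ}

/-- The rank of a projection is its trace, so the rank condition is closed; the entries are bounded
because column `j` has squared norm `p j j ≤ 1`. -/
theorem isCompact_starProjections :
    IsCompact {p : Matrix (Fin d) (Fin d) ℂ | IsStarProjection p ∧ 2 ≤ p.rank} := by
  have heq : {p : Matrix (Fin d) (Fin d) ℂ | IsStarProjection p ∧ 2 ≤ p.rank} =
      {p | p * p = p} ∩ {p | pᴴ = p} ∩ {p | 2 ≤ p.trace.re} := by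
    ext p
    have hr : p * p = p → p.trace.re = p.rank := fun h => by rw [trace_eq_rank h, Complex.natCast_re]
    constructor
    · rintro ⟨⟨h1, h2⟩, h3⟩
      refine ⟨⟨h1, h2⟩, ?_⟩
      rw [Set.mem_ofPred_eq, hr h1]
      exact_mod_cast h3
    · rintro ⟨⟨h1, h2⟩, h3⟩
      rw [Set.mem_ofPred_eq, hr h1] at h3
      exact ⟨⟨h1, h2⟩, by exact_mod_cast h3⟩
  have hclosed : IsClosed {p : Matrix (Fin d) (Fin d) ℂ | IsStarProjection p ∧ 2 ≤ p.rank} := by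
    rw [heq]
    exact ((isClosed_eq (by fun_prop) continuous_id).inter
      (isClosed_eq (by fun_prop) continuous_id)).inter
      (isClosed_le continuous_const (by fun_prop))
  refine (isCompact_univ_pi fun i : Fin d => isCompact_univ_pi fun j : Fin d =>
    isCompact_closedBall (0 : ℂ) 1).of_isClosed_subset hclosed
    fun (p : Matrix (Fin d) (Fin d) ℂ) hp i _ j _ => ?_
  have h : ∀ j, ∑ k, ‖p k j‖ ^ 2 = (p j j).re := by
    intro j
    have h1 : (pᴴ * p) j j = p j j := by
      rw [show pᴴ = p from hp.1.isSelfAdjoint, show p * p = p from hp.1.isIdempotentElem]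
    rw [Matrix.mul_apply] at h1
    simp only [Matrix.conjTranspose_apply, Complex.star_def, Complex.conj_mul'] at h1
    rw [← h1]
    norm_cast
  have hle : ∀ i j, ‖p i j‖ ^ 2 ≤ (p j j).re := fun i j => by
    rw [← h]
    exact Finset.single_le_sum (f := fun k => ‖p k j‖ ^ 2) (fun k _ => sq_nonneg _)
      (Finset.mem_univ i)
  have hre : (p j j).re ≤ 1 := by
    have h1 := hle j j
    have h2 := Complex.re_le_norm (p j j)
    nlinarith [norm_nonneg (p j j)]
  rw [mem_closedBall_zero_iff, ← sq_le_one_iff₀ (norm_nonneg _)]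
  exact (hle i j).trans hre

/-- A continuous function whose zeros among nonzero projections `p` are those with `p M p = l p` for
some `l ≤ 1`, for positive semidefinite `M`. -/
noncomputable def grayDefect (p M : Matrix (Fin d) (Fin d) ℂ) : ℝ :=
  ∑ i, ∑ j, ‖(p.trace • (p * M * p) - (p * M * p).trace • p) i j‖ +
    max 0 ((p * M * p).trace.re - p.trace.re)

theorem continuous_grayDefect {X : Type*} [TopologicalSpace X]
    {p M : X → Matrix (Fin d) (Fin d) ℂ} (hp : Continuous p) (hM : Continuous M) :
    Continuous fun x => grayDefect (p x) (M x) := by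
  unfold grayDefect
  fun_prop

theorem grayDefect_nonneg (p M : Matrix (Fin d) (Fin d) ℂ) : 0 ≤ grayDefect p M := by
  unfold grayDefect
  positivity

/-- The only candidate for `l` is `tr (p * M * p) / tr p`. Clearing the denominator makes the defect
continuous in `p`; the second summand of the defect encodes `l ≤ 1`, and `0 ≤ l` comes from the
positivity of `M`. -/
theorem grayDefect_eq_zero_iff {p M : Matrix (Fin d) (Fin d) ℂ} (hp : IsStarProjection p)
    (hr : 2 ≤ p.rank) (hM : M.PosSemidef) :
    grayDefect p M = 0 ↔ ∃ l : ℝ, 0 ≤ l ∧ l ≤ 1 ∧ p * M * p = (l : ℂ) • p := by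
  have hpos : (0 : ℝ) < p.rank := by
    have : 0 < p.rank := by omega
    exact_mod_cast this
  have hneC : (p.rank : ℂ) ≠ 0 := by exact_mod_cast hpos.ne'
  have htr := trace_eq_rank (show p * p = p from hp.isIdempotentElem)
  unfold grayDefect
  rw [add_eq_zero_iff_of_nonneg (by positivity) (le_max_left _ _), max_eq_left_iff, sub_nonpos, htr,
    Complex.natCast_re]
  constructor
  · rintro ⟨h1, h2⟩
    have hpsd : (p * M * p).PosSemidef := by
      have := hM.mul_mul_conjTranspose_same p
      rwa [show pᴴ = p from hp.isSelfAdjoint] at this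
    have ht := Complex.le_def.1 hpsd.trace_nonneg
    have htC : (p * M * p).trace = ((p * M * p).trace.re : ℂ) :=
      Complex.ext rfl (by simpa using ht.2.symm)
    have h3 : (p.rank : ℂ) • (p * M * p) - (p * M * p).trace • p = 0 := by
      ext i j
      rw [Finset.sum_eq_zero_iff_of_nonneg fun _ _ => by positivity] at h1
      have h4 := h1 i (Finset.mem_univ i)
      rw [Finset.sum_eq_zero_iff_of_nonneg fun _ _ => by positivity] at h4
      exact norm_eq_zero.1 (h4 j (Finset.mem_univ j))
    refine ⟨(p * M * p).trace.re / p.rank, div_nonneg ht.1 hpos.le,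
      (div_le_one hpos).2 h2, ?_⟩
    rw [sub_eq_zero, htC] at h3
    rw [Complex.ofReal_div, Complex.ofReal_natCast, div_eq_inv_mul, mul_smul, ← h3, smul_smul,
      inv_mul_cancel₀ hneC, one_smul]
  · rintro ⟨l, h0, h1, hl⟩
    rw [hl, Matrix.trace_smul, htr]
    constructor
    · refine Finset.sum_eq_zero fun i _ => Finset.sum_eq_zero fun j _ => ?_
      simp only [smul_smul, Matrix.sub_apply, Matrix.smul_apply, smul_eq_mul]
      rw [norm_eq_zero]
      ring
    · rw [smul_eq_mul, Complex.re_ofReal_mul, Complex.natCast_re]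
      exact mul_le_of_le_one_left hpos.le h1

theorem darkProjections_eq [Fintype A] (V : Ω → A → Matrix (Fin d) (Fin d) ℂ) (θ : Ω → Ω)
    (ω : Ω) :
    darkProjections V θ ω = {p | IsStarProjection p ∧ 2 ≤ p.rank} ∩
      {p | ∀ n, ∑ a : Fin n → A,
        grayDefect p ((krausProduct V θ ω n a)ᴴ * krausProduct V θ ω n a) = 0} := by
  ext p
  rw [mem_darkProjections, ← and_assoc]
  refine and_congr_right fun hp => forall_congr' fun n => ?_
  rw [Finset.sum_eq_zero_iff_of_nonneg fun _ _ => grayDefect_nonneg _ _]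
  simp only [Finset.mem_univ, true_imp_iff]
  exact forall_congr' fun a => (grayDefect_eq_zero_iff hp.1 hp.2
    (Matrix.posSemidef_conjTranspose_mul_self _)).symm

theorem continuous_sum_grayDefect [Fintype A] (V : Ω → A → Matrix (Fin d) (Fin d) ℂ) (θ : Ω → Ω)
    (n : ℕ) (ω : Ω) : Continuous fun p => ∑ a : Fin n → A,
      grayDefect p ((krausProduct V θ ω n a)ᴴ * krausProduct V θ ω n a) :=
  continuous_finsetSum _ fun _ _ =>
    continuous_grayDefect continuous_id continuous_const

theorem isCompact_darkProjections [Fintype A] (V : Ω → A → Matrix (Fin d) (Fin d) ℂ) (θ : Ω → Ω)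
    (ω : Ω) : IsCompact (darkProjections V θ ω) := by
  rw [darkProjections_eq]
  refine isCompact_starProjections.inter_right ?_
  rw [Set.ofPred_forall]
  exact isClosed_iInter fun n => isClosed_eq (continuous_sum_grayDefect V θ n ω) continuous_const

theorem measurableSet_darkProjections_inter_nonempty [Fintype A] [MeasurableSpace Ω]
    {V : Ω → A → Matrix (Fin d) (Fin d) ℂ} {θ : Ω → Ω}
    (hV : ∀ a i j, Measurable fun ω => V ω a i j) (hθ : Measurable θ)
    {K : Set (Matrix (Fin d) (Fin d) ℂ)} (hK : IsCompact K) :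
    MeasurableSet {ω | (darkProjections V θ ω ∩ K).Nonempty} := by
  have : SecondCountableTopology (Matrix (Fin d) (Fin d) ℂ) :=
    inferInstanceAs (SecondCountableTopology (Fin d → Fin d → ℂ))
  have h := measurableSet_exists_common_zero (isCompact_starProjections.inter hK)
    (continuous_sum_grayDefect V θ) (fun n p => ?_)
    fun n ω p => Finset.sum_nonneg fun _ _ => grayDefect_nonneg _ _
  · convert h using 3 with ω
    rw [darkProjections_eq]
    constructor
    · rintro ⟨p, ⟨h1, h2⟩, h3⟩
      exact ⟨p, ⟨h1, h3⟩, h2⟩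
    · rintro ⟨p, ⟨h1, h3⟩, h2⟩
      exact ⟨p, ⟨h1, h2⟩, h3⟩
  · refine Finset.measurable_fun_sum _ fun a _ =>
      measurable_continuous_comp_matrix (measurable_krausProduct hV hθ n a)
        (f := fun W => grayDefect p (Wᴴ * W)) ?_
    exact continuous_grayDefect continuous_const (by fun_prop)

theorem isRandomCompactSet_darkProjections [Fintype A] [MeasurableSpace Ω]
    {V : Ω → A → Matrix (Fin d) (Fin d) ℂ} {θ : Ω → Ω}
    (hV : ∀ a i j, Measurable fun ω => V ω a i j) (hθ : Measurable θ) :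
    IsRandomCompactSet (darkProjections V θ) := by
  have : SecondCountableTopology (Matrix (Fin d) (Fin d) ℂ) :=
    inferInstanceAs (SecondCountableTopology (Fin d → Fin d → ℂ))
  have : TopologicalSpace.MetrizableSpace (Matrix (Fin d) (Fin d) ℂ) :=
    inferInstanceAs (TopologicalSpace.MetrizableSpace (Fin d → Fin d → ℂ))
  refine isRandomCompactSet_of_hit isCompact_starProjections (fun ω => ?_)
    (isCompact_darkProjections V θ)
    fun K hK => measurableSet_darkProjections_inter_nonempty hV hθ hK
  rw [darkProjections_eq]
  exact Set.inter_subset_left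

end DarkRandom

end DisorderedKraus

theorem mainTheorem1 {Ω A : Type*} [MeasurableSpace Ω] [Fintype A] [MeasurableSpace A]
    [DiscreteMeasurableSpace A] (P : Measure Ω) [IsProbabilityMeasure P]
    (θ : Ω ≃ᵐ Ω) (hθ : Ergodic θ P) {d : ℕ}
    (V : Ω → A → Matrix (Fin d) (Fin d) ℂ)
    (hV : DisorderedKraus.IsPerfectKrausEnsemble P V) :
    (DisorderedKraus.IsRandomCompactSet (DisorderedKraus.darkProjections V θ) ∧
      ∀ K : Set (Matrix (Fin d) (Fin d) ℂ), IsCompact K →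
        MeasurableSet {ω | (DisorderedKraus.darkProjections V θ ω ∩ K).Nonempty}) ∧
    DisorderedKraus.purificationEvent V θ =ᵐ[P]
      {ω | DisorderedKraus.darkProjections V θ ω = ∅} ∧
    (DisorderedKraus.AsymptoticallyPurifies P V θ ↔
      0 < P {ω | DisorderedKraus.darkProjections V θ ω = ∅}) := by
  have horb := DisorderedKraus.ae_kraus_orbit hθ.toMeasurePreserving hV
  have hsub : ∀ᵐ ω ∂P, ω ∈ DisorderedKraus.purificationEvent V θ →
      DisorderedKraus.darkProjections V θ ω = ∅ := by
    filter_upwards [horb] with ω hω hX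
    exact Set.eq_empty_of_forall_notMem fun p hp =>
      DisorderedKraus.notMem_purificationEvent hω hp hX
  have hfull : 0 < P {ω | DisorderedKraus.darkProjections V θ ω = ∅} →
      DisorderedKraus.AsymptoticallyPurifies P V θ := by
    intro hpos
    filter_upwards [horb, DisorderedKraus.ae_tendsto_totalArea hθ hV hpos] with ω h1 h2
    exact DisorderedKraus.mem_purificationEvent h1 h2
  refine ⟨⟨DisorderedKraus.isRandomCompactSet_darkProjections hV.measurable θ.measurable,
    fun K hK => DisorderedKraus.measurableSet_darkProjections_inter_nonempty hV.measurable
      θ.measurable hK⟩, ?_, fun h => ?_, hfull⟩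
  · rw [eventuallyEq_set]
    -- Either there are no dark projections with positive probability, and both events are full, or
    -- both are null.
    by_cases hpos : 0 < P {ω | DisorderedKraus.darkProjections V θ ω = ∅}
    · filter_upwards [hsub, hfull hpos] with ω h1 h2
      exact ⟨h1, fun _ => h2⟩
    · filter_upwards [hsub, measure_eq_zero_iff_ae_notMem.1 (nonpos_iff_eq_zero.1 (not_lt.1 hpos))]
        with ω h1 h2
      exact ⟨h1, fun h => absurd h h2⟩
  · refine pos_iff_ne_zero.2 fun h0 => ?_
    obtain ⟨ω, h1, h2, h3⟩ := (h.and (hsub.and (measure_eq_zero_iff_ae_notMem.1 h0))).exists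
    exact h3 (h2 h1)
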